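/- All manifolds, bundles, maps and sections are smooth; manifolds are Hausdorff, second countable and connected. Let $M$ be an oriented four-manifold and $g$ a Lorentzian metric on $M$ of signature $(3,1)$. Let $\mathcal{D}=(\Sigma,\Xi)$ be a scalar-electromagnetic structure, that is: - $\Sigma=(\mathcal{M},\mathcal{G},\Phi)$, where $(\mathcal{M},\mathcal{G})$ is a Riemannian manifold and $\Phi\in\mathcal{C}^\infty(\mathcal{M},\mathbb{R})$; - $\Xi=(\mathcal{S},D,J,\omega)$, where $\mathcal{S}$ is a real vector bundle of finite rank over $\mathcal{M}$, $\omega$ is a symplectic pairing on $\mathcal{S}$, $D$ is a flat connection on $\mathcal{S}$ for which $\omega$ is parallel, and $J$ is a taming of $(\mathcal{S},\omega)$: an endomorphism of $\mathcal{S}$ with $J^2=-1$, $\omega(J\cdot,J\cdot)=\omega$ and $Q:=\omega(J\cdot,\cdot)$ positive definite. Let $\Theta=D\circ J-J\circ D\in\Omega^1(\mathcal{M},\mathrm{End}(\mathcal{S}))$ and $\Psi=(\sharp_{\mathcal{G}}\otimes\mathrm{id})(\Theta)\in\Gamma(\mathcal{M},T\mathcal{M}\otimes \mathrm{End}(\mathcal{S}))$.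 The superscript $\varphi$ denotes pullback along a map $\varphi:M\to\mathcal{M}$. The set $\mathrm{Conf}^g_{\mathcal{D}}(M)$ of global configurations consists of the pairs $(\varphi,\mathcal{V})$ with $\varphi\in\mathcal{C}^\infty(M,\mathcal{M})$ and $\mathcal{V}\in\Omega^2(M,\mathcal{S}^\varphi)$ which is positively polarized, i.e. $(\ast_g\otimes J^\varphi)\mathcal{V}=\mathcal{V}$, where $\ast_g$ is the Hodge operator. The set $\mathrm{Sol}^g_{\mathcal{D}}(M)$ of global scalar-electromagnetic solutions consists of those $(\varphi,\mathcal{V})\in \mathrm{Conf}^g_{\mathcal{D}}(M)$ which satisfy $$\mathrm{Tr}_g\nabla \mathrm{d}\varphi-(\mathrm{grad}_{\mathcal{G}}\Phi)^\varphi-\tfrac12\,(\ast_g\mathcal{V},\Psi^\varphi\mathcal{V})=0 \quad\text{(scalar equation)},\qquad \mathrm{d}_{D^\varphi}\mathcal{V}=0\quad\text{(twisted electromagnetic equation)}.$$ Here $\nabla$ is induced by the Levi-Civita connections of $g$ and $\mathcal{G}$, the pairing $(\cdot,\cdot)$ is induced by $g$ and $Q^\varphi$ and extended trivially to a $(T\mathcal{M})^\varphi$-valued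 pairing, and $\mathrm{d}_{D^\varphi}$ is the de Rham differential twisted by $D^\varphi$. An unbased automorphism of $\mathcal{S}$ is a diffeomorphism $f$ of the total space of $\mathcal{S}$ which maps fibers linearly and isomorphically onto fibers and covers a diffeomorphism $f_0$ of $\mathcal{M}$; let $\hat f:\mathcal{S}\to\mathcal{S}^{f_0}$ be the induced based isomorphism. Let $\mathrm{Aut}(\mathcal{D})$ be the group of unbased automorphisms $f$ of $\mathcal{S}$ which preserve $\omega$, are covariantly constant with respect to $D$ (i.e. commute with $D$), satisfy $\mathbf{Ad}(f)(J):=f\circ J\circ f^{-1}=J$, and for which $f_0$ is an isometry of $(\mathcal{M},\mathcal{G})$ with $\Phi\circ f_0=\Phi$. Define the duality action by $f\diamond(\varphi,\mathcal{V})=(f_0\circ\varphi,\hat f^\varphi(\mathcal{V}))$. **Claim.** For every $f\in\mathrm{Aut}(\mathcal{D})$, $$f\diamond \mathrm{Sol}^g_{\mathcal{D}}(M)=\mathrm{Sol}^g_{\mathcal{D}}(M).$$ Thus $\mathrm{Aut}(\mathcal{D})$ acts by symmetries of the scalar and twisted electromagnetic equations for every fixed Lorentzian metric $g$: for every $(\varphi,\mathcal{V})\in\mathrm{Conf}^g_{\mathcal{D}}(M)$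 the pair $f\diamond(\varphi,\mathcal{V})$ lies in $\mathrm{Conf}^g_{\mathcal{D}}(M)$, and it is a solution if and only if $(\varphi,\mathcal{V})$ is. -/

import Mathlib

open Bundle Module FiberBundle
open scoped Manifold ContDiff Topology TensorProduct


noncomputable section

namespace ESM

/-! ### Pseudo-Riemannian metrics and the Levi-Civita connection -/

section Metrics

variable {E : Type*} [NormedAddCommGroup E] [NormedSpace ℝ E]
  {N : Type*} [TopologicalSpace N] [ChartedSpace E N]

instance [FiniteDimensional ℝ E] (x : N) : FiniteDimensional ℝ (TangentSpace 𝓘(ℝ, E) x) :=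
  inferInstanceAs (FiniteDimensional ℝ E)

instance (x : N) : T2Space (TangentSpace 𝓘(ℝ, E) x) := inferInstanceAs (T2Space E)

variable (E N) in
/-- A smooth pseudo-Riemannian metric on a manifold without boundary modelled on `E`. -/
structure PseudoRiemannianMetric [IsManifold 𝓘(ℝ, E) ∞ N] where
  /-- the scalar product on each tangent space -/
  val (x : N) : TangentSpace 𝓘(ℝ, E) x →L[ℝ] TangentSpace 𝓘(ℝ, E) x →L[ℝ] ℝ
  symm (x : N) (v w : TangentSpace 𝓘(ℝ, E) x) : val x v w = val x w v
  nondegenerate (x : N) (v : TangentSpace 𝓘(ℝ, E) x) (hv : ∀ w, val x v w = 0) : v = 0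
  contMDiff : ContMDiff 𝓘(ℝ, E) (𝓘(ℝ, E).prod 𝓘(ℝ, E →L[ℝ] E →L[ℝ] ℝ)) ∞
    (fun x ↦ TotalSpace.mk' (E →L[ℝ] E →L[ℝ] ℝ)
      (E := fun x : N ↦ TangentSpace 𝓘(ℝ, E) x →L[ℝ] TangentSpace 𝓘(ℝ, E) x →L[ℝ] ℝ) x (val x))

variable [IsManifold 𝓘(ℝ, E) ∞ N]

/-- A Riemannian metric, seen as a pseudo-Riemannian metric. -/
def PseudoRiemannianMetric.ofRiemannian
    (G : ContMDiffRiemannianMetric 𝓘(ℝ, E) ∞ E (TangentSpace 𝓘(ℝ, E) : N → Type _)) :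
    PseudoRiemannianMetric E N where
  val := G.inner
  symm := G.symm
  nondegenerate x v hv := by
    by_contra h
    exact (G.pos x v h).ne' (hv v)
  contMDiff := G.contMDiff

namespace PseudoRiemannianMetric

variable (h : PseudoRiemannianMetric E N)

/-- The metric at a point, as an algebraic bilinear form. -/
def bilin (x : N) : LinearMap.BilinForm ℝ (TangentSpace 𝓘(ℝ, E) x) :=
  (ContinuousLinearMap.coeLM ℝ).comp (h.val x).toLinearMap

@[simp] lemma bilin_apply (x : N) (v w : TangentSpace 𝓘(ℝ, E) x) :
    h.bilin x v w = h.val x v w := rfl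

lemma bilin_nondegenerate (x : N) : (h.bilin x).Nondegenerate :=
  ⟨fun v hv ↦ h.nondegenerate x v hv,
    fun v hv ↦ h.nondegenerate x v fun w ↦ (h.symm x v w).trans (hv w)⟩

/-- The musical isomorphism `♯ : T*N → TN`, characterised by `h (♯ α) w = α w`. -/
def sharp [FiniteDimensional ℝ E] (x : N) :
    Dual ℝ (TangentSpace 𝓘(ℝ, E) x) ≃ₗ[ℝ] TangentSpace 𝓘(ℝ, E) x :=
  ((h.bilin x).toDual (h.bilin_nondegenerate x)).symm

@[simp] lemma val_sharp [FiniteDimensional ℝ E] (x : N)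
    (α : Dual ℝ (TangentSpace 𝓘(ℝ, E) x)) (w : TangentSpace 𝓘(ℝ, E) x) :
    h.val x (h.sharp x α) w = α w :=
  LinearMap.BilinForm.apply_toDual_symm_apply (hB := h.bilin_nondegenerate x) α w

/-- The function `h(X, Y)`. -/
def pair (X Y : Π x : N, TangentSpace 𝓘(ℝ, E) x) (x : N) : ℝ := h.val x (X x) (Y x)

/-- The right-hand side of the Koszul formula for `2 h(∇_X Y, Z)`. -/
def koszul (X Y Z : Π x : N, TangentSpace 𝓘(ℝ, E) x) (x : N) : ℝ :=
  (d% (h.pair Y Z)) x (X x) + (d% (h.pair X Z)) x (Y x) - (d% (h.pair X Y)) x (Z x)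
    + h.val x (VectorField.mlieBracket 𝓘(ℝ, E) X Y x) (Z x)
    - h.val x (VectorField.mlieBracket 𝓘(ℝ, E) X Z x) (Y x)
    - h.val x (VectorField.mlieBracket 𝓘(ℝ, E) Y Z x) (X x)

variable {h} {X X' Y Z : Π x : N, TangentSpace 𝓘(ℝ, E) x} {x : N}

lemma mdifferentiableAt_pair (hX : MDiffAt (T% X) x) (hY : MDiffAt (T% Y) x) :
    MDiffAt (h.pair X Y) x := by
  have h1 : MDifferentiableAt 𝓘(ℝ, E) (𝓘(ℝ, E).prod 𝓘(ℝ, ℝ))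
      (fun y ↦ TotalSpace.mk' ℝ (E := Bundle.Trivial N ℝ) y (h.val y (X y) (Y y))) x := by
    apply MDifferentiableAt.clm_bundle_apply₂ (F₁ := E) (F₂ := E)
    · exact h.contMDiff.mdifferentiableAt (by simp)
    · exact hX
    · exact hY
  simp only [mdifferentiableAt_totalSpace] at h1
  exact h1.2

lemma pair_comm (X Y : Π x : N, TangentSpace 𝓘(ℝ, E) x) : h.pair X Y = h.pair Y X :=
  funext fun y ↦ h.symm y _ _

lemma pair_add_left (X X' Y : Π x : N, TangentSpace 𝓘(ℝ, E) x) :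
    h.pair (X + X') Y = h.pair X Y + h.pair X' Y := by
  ext y; simp [pair]

lemma pair_add_right (X Y Y' : Π x : N, TangentSpace 𝓘(ℝ, E) x) :
    h.pair X (Y + Y') = h.pair X Y + h.pair X Y' := by
  ext y; simp [pair]

lemma pair_smul_left (f : N → ℝ) (X Y : Π x : N, TangentSpace 𝓘(ℝ, E) x) :
    h.pair (f • X) Y = f * h.pair X Y := by
  ext y; simp [pair]

lemma pair_smul_right (f : N → ℝ) (X Y : Π x : N, TangentSpace 𝓘(ℝ, E) x) :
    h.pair X (f • Y) = f * h.pair X Y := by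
  ext y; simp [pair]

variable [FiniteDimensional ℝ E]

lemma tensorialAt_koszul_left (hY : MDiffAt (T% Y) x) (hZ : MDiffAt (T% Z) x) :
    TensorialAt 𝓘(ℝ, E) E (fun X ↦ h.koszul X Y Z x) x where
  smul {f X} hf hX := by
    have e1 := mdifferentiableAt_pair (h := h) hX hY
    have e2 := mdifferentiableAt_pair (h := h) hX hZ
    simp [koszul, pair_smul_left, mvfderiv_mul hf e1, mvfderiv_mul hf e2,
      VectorField.mlieBracket_smul_left hf hX]
    simp only [pair]
    ring
  add {X X'} hX hX' := by
    have e1 := mdifferentiableAt_pair (h := h) hX hY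
    have e2 := mdifferentiableAt_pair (h := h) hX hZ
    have e1' := mdifferentiableAt_pair (h := h) hX' hY
    have e2' := mdifferentiableAt_pair (h := h) hX' hZ
    simp [koszul, pair_add_left, mvfderiv_add e1 e1', mvfderiv_add e2 e2',
      VectorField.mlieBracket_add_left hX hX']
    ring

lemma tensorialAt_koszul_right (hX : MDiffAt (T% X) x) (hY : MDiffAt (T% Y) x) :
    TensorialAt 𝓘(ℝ, E) E (fun Z ↦ h.koszul X Y Z x) x where
  smul {f Z} hf hZ := by
    have e1 := mdifferentiableAt_pair (h := h) hY hZ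
    have e2 := mdifferentiableAt_pair (h := h) hX hZ
    simp [koszul, pair_smul_right, mvfderiv_mul hf e1, mvfderiv_mul hf e2,
      VectorField.mlieBracket_smul_right hf hZ, h.symm x (Z x)]
    simp only [pair]
    ring
  add {Z Z'} hZ hZ' := by
    have e1 := mdifferentiableAt_pair (h := h) hY hZ
    have e2 := mdifferentiableAt_pair (h := h) hX hZ
    have e1' := mdifferentiableAt_pair (h := h) hY hZ'
    have e2' := mdifferentiableAt_pair (h := h) hX hZ'
    simp [koszul, pair_add_right, mvfderiv_add e1 e1', mvfderiv_add e2 e2',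
      VectorField.mlieBracket_add_right hZ hZ']
    ring

variable (h) in
/-- The Koszul form at `x`, as a bilinear map of the two vectors `X x` and `Z x`. -/
def koszulForm (Y : Π x : N, TangentSpace 𝓘(ℝ, E) x) (x : N) (hY : MDiffAt (T% Y) x) :
    TangentSpace 𝓘(ℝ, E) x →L[ℝ] TangentSpace 𝓘(ℝ, E) x →L[ℝ] ℝ :=
  TensorialAt.mkHom₂ (I := 𝓘(ℝ, E)) (F := E) (F' := E) (fun X Z ↦ h.koszul X Y Z x) x
    (fun _ hZ ↦ tensorialAt_koszul_left hY hZ) (fun _ hX ↦ tensorialAt_koszul_right hX hY)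

lemma koszulForm_apply (hX : MDiffAt (T% X) x) (hY : MDiffAt (T% Y) x) (hZ : MDiffAt (T% Z) x) :
    h.koszulForm Y x hY (X x) (Z x) = h.koszul X Y Z x :=
  TensorialAt.mkHom₂_apply (I := 𝓘(ℝ, E)) (F := E) (F' := E) _ _ hX hZ

open Classical in
variable (h) in
/-- `v ↦ ∇_v Y`, where `∇` is the Levi-Civita connection of `h`, determined by the Koszul
formula. -/
def leviCivitaAux (Y : Π x : N, TangentSpace 𝓘(ℝ, E) x) (x : N) :
    TangentSpace 𝓘(ℝ, E) x →L[ℝ] TangentSpace 𝓘(ℝ, E) x :=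
  if hY : MDiffAt (T% Y) x then
    LinearMap.toContinuousLinearMap <| (1 / 2 : ℝ) •
      ((h.sharp x).toLinearMap ∘ₗ (ContinuousLinearMap.coeLM ℝ).comp
        (h.koszulForm Y x hY).toLinearMap)
  else 0

lemma val_leviCivitaAux (hX : MDiffAt (T% X) x) (hY : MDiffAt (T% Y) x) (hZ : MDiffAt (T% Z) x) :
    2 * h.val x (h.leviCivitaAux Y x (X x)) (Z x) = h.koszul X Y Z x := by
  rw [← koszulForm_apply hX hY hZ, leviCivitaAux, dif_pos hY]
  simp

lemma leviCivitaAux_eq_of_koszul (hY : MDiffAt (T% Y) x)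
    (A : TangentSpace 𝓘(ℝ, E) x →L[ℝ] TangentSpace 𝓘(ℝ, E) x)
    (H : ∀ X Z : Π x : N, TangentSpace 𝓘(ℝ, E) x, MDiffAt (T% X) x → MDiffAt (T% Z) x →
      2 * h.val x (A (X x)) (Z x) = h.koszul X Y Z x) :
    h.leviCivitaAux Y x = A := by
  ext1 v
  refine sub_eq_zero.1 (h.nondegenerate x _ fun w ↦ ?_)
  have hv := mdifferentiableAt_extend 𝓘(ℝ, E) E (x := x) v
  have hw := mdifferentiableAt_extend 𝓘(ℝ, E) E (x := x) w
  have e1 := val_leviCivitaAux (h := h) hv hY hw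
  have e2 := H _ _ hv hw
  simp only [extend_apply_self] at e1 e2
  rw [map_sub, sub_apply]
  linarith

variable (h) in
/-- The Levi-Civita connection of a pseudo-Riemannian metric. -/
def leviCivita : CovariantDerivative 𝓘(ℝ, E) E (TangentSpace 𝓘(ℝ, E) : N → Type _) where
  toFun := h.leviCivitaAux
  isCovariantDerivativeOnUniv :=
    { add := by
        intro Y Y' x hY hY' _
        refine leviCivitaAux_eq_of_koszul (mdifferentiableAt_add_section hY hY') _ ?_
        intro X Z hX hZ
        have e1 := val_leviCivitaAux (h := h) hX hY hZ
        have e2 := val_leviCivitaAux (h := h) hX hY' hZ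
        rw [add_apply, map_add, add_apply, mul_add, e1, e2]
        have e1 := mdifferentiableAt_pair (h := h) hY hZ
        have e2 := mdifferentiableAt_pair (h := h) hX hY
        have e1' := mdifferentiableAt_pair (h := h) hY' hZ
        have e2' := mdifferentiableAt_pair (h := h) hX hY'
        simp [koszul, pair_add_right, pair_add_left, mvfderiv_add e1 e1', mvfderiv_add e2 e2',
          VectorField.mlieBracket_add_right hY hY', VectorField.mlieBracket_add_left hY hY']
        ring
      leibniz := by
        intro Y f x hY hf _
        refine leviCivitaAux_eq_of_koszul (hf.smul_section hY) _ ?_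
        intro X Z hX hZ
        have e0 := val_leviCivitaAux (h := h) hX hY hZ
        have e1 := mdifferentiableAt_pair (h := h) hY hZ
        have e2 := mdifferentiableAt_pair (h := h) hX hY
        simp [koszul, pair_smul_left, pair_smul_right, mvfderiv_mul hf e1, mvfderiv_mul hf e2,
          VectorField.mlieBracket_smul_right hf hY, VectorField.mlieBracket_smul_left hf hY,
          h.symm x (Y x) (X x)] at e0 ⊢
        simp only [pair] at e0 ⊢
        linear_combination f x * e0 }

lemma torsion_leviCivita : h.leviCivita.torsion = 0 := by
  rw [CovariantDerivative.torsion_eq_zero_iff]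
  intro X Y x hX hY
  refine sub_eq_zero.1 (h.nondegenerate x _ fun w ↦ ?_)
  have hw := mdifferentiableAt_extend 𝓘(ℝ, E) E (x := x) w
  have e1 := val_leviCivitaAux (h := h) hX hY hw
  have e2 := val_leviCivitaAux (h := h) hY hX hw
  simp [koszul, pair_comm Y X, VectorField.mlieBracket_swap_apply (V := Y) (W := X)] at e1 e2
  simp [leviCivita]
  linarith

lemma mvfderiv_pair (hX : MDiffAt (T% X) x) (hY : MDiffAt (T% Y) x) (hZ : MDiffAt (T% Z) x) :
    (d% (h.pair Y Z)) x (X x) =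
      h.val x (h.leviCivita Y x (X x)) (Z x) + h.val x (Y x) (h.leviCivita Z x (X x)) := by
  have e1 := val_leviCivitaAux (h := h) hX hY hZ
  have e2 := val_leviCivitaAux (h := h) hX hZ hY
  simp [koszul, pair_comm Z Y, VectorField.mlieBracket_swap_apply (V := Z) (W := Y)] at e1 e2
  rw [h.symm x (Y x)]
  simp [leviCivita]
  linarith

end PseudoRiemannianMetric
end Metrics

/-! ### Connections and pulled-back connections -/

section Connections

variable {E : Type*} [NormedAddCommGroup E] [NormedSpace ℝ E]
  {N : Type*} [TopologicalSpace N] [ChartedSpace E N] [IsManifold 𝓘(ℝ, E) ∞ N]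
  (F : Type*) [NormedAddCommGroup F] [NormedSpace ℝ F]
  {S : N → Type*} [TopologicalSpace (TotalSpace F S)]
  [∀ y, AddCommGroup (S y)] [∀ y, Module ℝ (S y)] [∀ y, TopologicalSpace (S y)]
  [∀ y, IsTopologicalAddGroup (S y)] [∀ y, ContinuousSMul ℝ (S y)]
  [FiberBundle F S]
  {E' : Type*} [NormedAddCommGroup E'] [NormedSpace ℝ E']
  {M : Type*} [TopologicalSpace M] [ChartedSpace E' M]

/-- The pulled-back connection `D^φ` on `S^φ`, applied to a section `s` of `S^φ`. In the
preferred trivialization of `S` at `φ x`, with connection form `A`, this is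
`D^φ_u s = d s (u) + A (dφ u) s`: the second summand is the covariant derivative along `dφ u` of
the section of `S` which is constant in that trivialization and takes the value `s x` at `φ x`. -/
def pullbackConnection (D : CovariantDerivative 𝓘(ℝ, E) F S) (φ : M → N)
    (s : Π x : M, S (φ x)) (x : M) (u : TangentSpace 𝓘(ℝ, E') x) : S (φ x) :=
  (trivializationAt F S (φ x)).symm (φ x)
      ((d% (fun x' : M ↦ (trivializationAt F S (φ x) ⟨φ x', s x'⟩).2)) x u)
    + D (extend F (s x)) (φ x) (mfderiv 𝓘(ℝ, E') 𝓘(ℝ, E) φ x u)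

/-- The value at `x` of `d_{D^φ} V` on vector fields `X, Y, Z`, for an `S^φ`-valued two-form `V`. -/
def twistedExtDeriv (D : CovariantDerivative 𝓘(ℝ, E) F S) (φ : M → N)
    (V : Π x : M, TangentSpace 𝓘(ℝ, E') x [⋀^Fin 2]→ₗ[ℝ] S (φ x))
    (X Y Z : Π x : M, TangentSpace 𝓘(ℝ, E') x) (x : M) : S (φ x) :=
  pullbackConnection F D φ (fun x' ↦ V x' ![Y x', Z x']) x (X x)
    - pullbackConnection F D φ (fun x' ↦ V x' ![X x', Z x']) x (Y x)
    + pullbackConnection F D φ (fun x' ↦ V x' ![X x', Y x']) x (Z x)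
    - V x ![VectorField.mlieBracket 𝓘(ℝ, E') X Y x, Z x]
    + V x ![VectorField.mlieBracket 𝓘(ℝ, E') X Z x, Y x]
    - V x ![VectorField.mlieBracket 𝓘(ℝ, E') Y Z x, X x]

/-- The connection `D` is flat: `D_X D_Y σ - D_Y D_X σ - D_{[X,Y]} σ = 0`. -/
def IsFlat (D : CovariantDerivative 𝓘(ℝ, E) F S) : Prop :=
  ∀ (X Y : Π y : N, TangentSpace 𝓘(ℝ, E) y) (σ : Π y : N, S y),
    CMDiff ∞ (T% X) → CMDiff ∞ (T% Y) → CMDiff ∞ (T% σ) → ∀ y : N,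
      D (fun z ↦ D σ z (Y z)) y (X y) - D (fun z ↦ D σ z (X z)) y (Y y)
        - D σ y (VectorField.mlieBracket 𝓘(ℝ, E) X Y y) = 0

end Connections

/-! ### Duality structures and electromagnetic structures -/

section Structures

variable {E : Type*} [NormedAddCommGroup E] [NormedSpace ℝ E]
  {N : Type*} [TopologicalSpace N] [ChartedSpace E N] [IsManifold 𝓘(ℝ, E) ∞ N]
  {F : Type*} [NormedAddCommGroup F] [NormedSpace ℝ F]
  {S : N → Type*} [TopologicalSpace (TotalSpace F S)]
  [∀ y, AddCommGroup (S y)] [∀ y, Module ℝ (S y)] [∀ y, TopologicalSpace (S y)]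
  [∀ y, IsTopologicalAddGroup (S y)] [∀ y, ContinuousSMul ℝ (S y)]
  [FiberBundle F S] [VectorBundle ℝ F S] [ContMDiffVectorBundle ∞ F S 𝓘(ℝ, E)]

variable (E N) in
/-- A scalar structure `(N, G, Φ)`: a Riemannian metric and a smooth potential on `N`. -/
structure ScalarStructure where
  /-- the Riemannian metric -/
  G : ContMDiffRiemannianMetric 𝓘(ℝ, E) ∞ E (TangentSpace 𝓘(ℝ, E) : N → Type _)
  /-- the scalar potential -/
  Φ : N → ℝ
  contMDiff_Φ : ContMDiff 𝓘(ℝ, E) 𝓘(ℝ, ℝ) ∞ Φ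

/-- The scalar metric as a pseudo-Riemannian metric. -/
def ScalarStructure.metric (𝒮 : ScalarStructure E N) : PseudoRiemannianMetric E N :=
  .ofRiemannian 𝒮.G

variable (E F S) in
/-- A duality structure `(S, D, ω)` on `N`: a flat connection and a parallel symplectic pairing on
the vector bundle `S`. -/
structure DualityStructure where
  /-- the flat connection -/
  D : CovariantDerivative 𝓘(ℝ, E) F S
  contMDiff_D : CovariantDerivative.ContMDiffCovariantDerivative D ∞
  flat : IsFlat F D
  /-- the symplectic pairing -/
  symp (y : N) : S y →L[ℝ] S y →L[ℝ] ℝ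
  contMDiff_symp : ContMDiff 𝓘(ℝ, E) (𝓘(ℝ, E).prod 𝓘(ℝ, F →L[ℝ] F →L[ℝ] ℝ)) ∞
    (fun y ↦ TotalSpace.mk' (F →L[ℝ] F →L[ℝ] ℝ)
      (E := fun y : N ↦ S y →L[ℝ] S y →L[ℝ] ℝ) y (symp y))
  symp_self (y : N) (s : S y) : symp y s s = 0
  symp_nondegenerate (y : N) (s : S y) (hs : ∀ t, symp y s t = 0) : s = 0
  symp_parallel (σ τ : Π y : N, S y) (y : N) (hσ : MDiffAt (T% σ) y) (hτ : MDiffAt (T% τ) y)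
    (u : TangentSpace 𝓘(ℝ, E) y) :
    (d% (fun z : N ↦ symp z (σ z) (τ z))) y u = symp y (D σ y u) (τ y) + symp y (σ y) (D τ y u)

/-- A taming of the symplectic vector bundle `(S, ω)`: a smooth complex structure `J` on `S`, which
is compatible with `ω` and for which `ω(J ·, ·)` is positive definite. -/
structure DualityStructure.IsTaming (Δ : DualityStructure E F S)
    (J : Π y : N, S y →L[ℝ] S y) : Prop where
  contMDiff : ContMDiff 𝓘(ℝ, E) (𝓘(ℝ, E).prod 𝓘(ℝ, F →L[ℝ] F)) ∞
    (fun y ↦ TotalSpace.mk' (F →L[ℝ] F) (E := fun y : N ↦ S y →L[ℝ] S y) y (J y))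
  sq (y : N) (s : S y) : J y (J y s) = -s
  compatible (y : N) (s t : S y) : Δ.symp y (J y s) (J y t) = Δ.symp y s t
  pos (y : N) (s : S y) (hs : s ≠ 0) : 0 < Δ.symp y (J y s) s

variable (E F S) in
/-- An electromagnetic structure `(S, D, J, ω)` on `N`. -/
structure ElectromagneticStructure extends DualityStructure E F S where
  /-- the taming -/
  J (y : N) : S y →L[ℝ] S y
  isTaming : toDualityStructure.IsTaming J

variable (E F S) in
/-- A scalar-electromagnetic structure: a scalar structure on `N` together with an electromagnetic
structure on `N`. -/
structure ScalarElectromagneticStructure where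
  /-- the scalar structure -/
  scalar : ScalarStructure E N
  /-- the electromagnetic structure -/
  em : ElectromagneticStructure E F S

namespace ElectromagneticStructure

variable (Ξ : ElectromagneticStructure E F S)

/-- The Euclidean scalar product `Q = ω(J ·, ·)`. -/
def Q (y : N) : S y →ₗ[ℝ] S y →ₗ[ℝ] ℝ :=
  (ContinuousLinearMap.coeLM ℝ).comp ((Ξ.symp y).comp (Ξ.J y)).toLinearMap

@[simp] lemma Q_apply (y : N) (s t : S y) : Ξ.Q y s t = Ξ.symp y (Ξ.J y s) t := rfl

lemma mdifferentiableAt_J {σ : Π y : N, S y} {y : N} (hσ : MDiffAt (T% σ) y) :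
    MDiffAt (T% (fun z ↦ Ξ.J z (σ z))) y :=
  MDifferentiableAt.clm_bundle_apply (F₁ := F) (F₂ := F)
    (Ξ.isTaming.contMDiff.mdifferentiableAt (by simp)) hσ

variable [FiniteDimensional ℝ F]

/-- `D ∘ J - J ∘ D` is `C^∞(N)`-linear. -/
lemma tensorialAt_fundamentalForm (y : N) :
    TensorialAt 𝓘(ℝ, E) F
      (fun σ : Π y : N, S y ↦ Ξ.D (fun z ↦ Ξ.J z (σ z)) y - (Ξ.J y).comp (Ξ.D σ y)) y where
  smul {f σ} hf hσ := by
    have e : (fun z ↦ Ξ.J z ((f • σ) z)) = f • fun z ↦ Ξ.J z (σ z) := by ext z; simp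
    rw [e, Ξ.D.isCovariantDerivativeOn.leibniz (Ξ.mdifferentiableAt_J hσ) hf, Ξ.D.isCovariantDerivativeOn.leibniz hσ hf]
    ext u
    simp
    module
  add {σ σ'} hσ hσ' := by
    have e : (fun z ↦ Ξ.J z ((σ + σ') z)) =
        (fun z ↦ Ξ.J z (σ z)) + fun z ↦ Ξ.J z (σ' z) := by ext z; simp
    rw [e, Ξ.D.isCovariantDerivativeOn.add (Ξ.mdifferentiableAt_J hσ) (Ξ.mdifferentiableAt_J hσ'), Ξ.D.isCovariantDerivativeOn.add hσ hσ']
    ext u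
    simp
    abel

/-- The fundamental form `Θ = D ∘ J - J ∘ D`, an `End(S)`-valued one-form:
`Θ(u) s = D_u (J σ) - J (D_u σ)` for any section `σ` with `σ y = s`. -/
def fundamentalForm (y : N) : TangentSpace 𝓘(ℝ, E) y →ₗ[ℝ] S y →ₗ[ℝ] S y :=
  ((ContinuousLinearMap.coeLM ℝ).comp
    (TensorialAt.mkHom (I := 𝓘(ℝ, E)) (F := F) _ y
      (Ξ.tensorialAt_fundamentalForm y)).toLinearMap).flip

lemma fundamentalForm_apply {σ : Π y : N, S y} {y : N} (hσ : MDiffAt (T% σ) y)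
    (u : TangentSpace 𝓘(ℝ, E) y) :
    Ξ.fundamentalForm y u (σ y) = Ξ.D (fun z ↦ Ξ.J z (σ z)) y u - Ξ.J y (Ξ.D σ y u) :=
  congr($(TensorialAt.mkHom_apply (I := 𝓘(ℝ, E)) (F := F)
    (Ξ.tensorialAt_fundamentalForm y) hσ) u)

end ElectromagneticStructure

/-- The fundamental field `Ψ = (♯ ⊗ id)(Θ)`, a section of `TN ⊗ End(S)`. -/
def ScalarElectromagneticStructure.fundamentalField [FiniteDimensional ℝ E] [FiniteDimensional ℝ F]
    (𝒟 : ScalarElectromagneticStructure E F S) (y : N) :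
    TangentSpace 𝓘(ℝ, E) y ⊗[ℝ] (S y →ₗ[ℝ] S y) :=
  TensorProduct.map (𝒟.scalar.metric.sharp y).toLinearMap LinearMap.id
    ((dualTensorHomEquiv ℝ (TangentSpace 𝓘(ℝ, E) y) (S y →ₗ[ℝ] S y)).symm
      (𝒟.em.fundamentalForm y))

end Structures

/-! ### Lorentzian four-manifolds -/

section Lorentzian

variable {M : Type*} [TopologicalSpace M] [ChartedSpace (EuclideanSpace ℝ (Fin 4)) M]

/-- Smooth vector fields on a four-manifold. -/
def IsSmoothVectorField [IsManifold (𝓡 4) ∞ M] (X : Π x : M, TangentSpace (𝓡 4) x) : Prop :=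
  ContMDiff (𝓡 4) (𝓡 4).tangent ∞ (fun x ↦ (X x : TangentBundle (𝓡 4) M))

variable (M) in
/-- An orientation of a four-manifold: a choice of orientation of each tangent space which is
locally constant in the trivializations of the tangent bundle induced by charts. -/
structure ManifoldOrientation [IsManifold (𝓡 4) ∞ M] where
  /-- the orientation of each tangent space -/
  toFun (x : M) : Orientation ℝ (TangentSpace (𝓡 4) x) (Fin 4)
  locallyConstant (x₀ : M) : ∃ o : Orientation ℝ (EuclideanSpace ℝ (Fin 4)) (Fin 4), ∀ᶠ x in 𝓝 x₀,
    ∀ hx : x ∈ (trivializationAt (EuclideanSpace ℝ (Fin 4)) (TangentSpace (𝓡 4)) x₀).baseSet,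
      Orientation.map (Fin 4) ((trivializationAt (EuclideanSpace ℝ (Fin 4)) (TangentSpace (𝓡 4)) x₀).continuousLinearEquivAt
        ℝ x hx).toLinearEquiv (toFun x) = o

variable (M) in
/-- A smooth metric of signature `(3,1)` on a four-manifold. -/
structure LorentzianMetric [IsManifold (𝓡 4) ∞ M] extends PseudoRiemannianMetric (EuclideanSpace ℝ (Fin 4)) M where
  signature (x : M) : ∃ e : Basis (Fin 4) ℝ (TangentSpace (𝓡 4) x),
    ∀ i j, val x (e i) (e j) = if i = j then (if i = 0 then -1 else 1) else 0

variable [IsManifold (𝓡 4) ∞ M]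

namespace LorentzianMetric

variable (g : LorentzianMetric M) (o : ManifoldOrientation M)

/-- The coordinate basis of the tangent space at `x`. The constructions below do not depend on
which basis is chosen. -/
def basis (x : M) : Basis (Fin 4) ℝ (TangentSpace (𝓡 4) x) :=
  (EuclideanSpace.basisFun (Fin 4) ℝ).toBasis

/-- The `g`-dual basis: `g (dualBasis i) (basis j) = δ i j`. -/
def dualBasis (x : M) : Basis (Fin 4) ℝ (TangentSpace (𝓡 4) x) :=
  (g.bilin x).dualBasis (g.bilin_nondegenerate x) (basis x)

/-- The trace with respect to `g`. -/
def trace {W : Type*} [AddCommGroup W] (x : M)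
    (B : TangentSpace (𝓡 4) x → TangentSpace (𝓡 4) x → W) : W :=
  ∑ i, B (basis x i) (g.dualBasis x i)

/-- The volume form of `g` and the orientation `o`. -/
def vol (x : M) : TangentSpace (𝓡 4) x [⋀^Fin 4]→ₗ[ℝ] ℝ :=
  √|(Matrix.of fun i j ↦ g.val x (basis x i) (basis x j)).det| • ((basis x).adjustToOrientation (o.toFun x)).det

variable {W : Type*} [AddCommGroup W] [Module ℝ W]

/-- The Hodge operator of `g` on `W`-valued two-forms:
`(∗ η) (u, v) = ½ η^{ij} vol (b i, b j, u, v)`, so that `α ∧ ∗ β = (α, β)_g vol`. -/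
def hodge (x : M) (η : TangentSpace (𝓡 4) x [⋀^Fin 2]→ₗ[ℝ] W) :
    TangentSpace (𝓡 4) x [⋀^Fin 2]→ₗ[ℝ] W :=
  (1 / 2 : ℝ) • ∑ i, ∑ j,
    (LinearMap.toSpanSingleton ℝ W (η ![g.dualBasis x i, g.dualBasis x j])).compAlternatingMap
      (((g.vol o x).curryLeft (basis x i)).curryLeft (basis x j))

/-- The scalar product induced on `W`-valued two-forms by `g` and a scalar product `Q` on `W`:
`(ρ, η) = ½ Q(ρ_{ij}, η^{ij})`, as a linear function of `η`. -/
def twoFormInner (x : M) (Q : W →ₗ[ℝ] W →ₗ[ℝ] ℝ) (ρ : TangentSpace (𝓡 4) x [⋀^Fin 2]→ₗ[ℝ] W) :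
    (TangentSpace (𝓡 4) x [⋀^Fin 2]→ₗ[ℝ] W) →ₗ[ℝ] ℝ where
  toFun η := (1 / 2 : ℝ) * ∑ i, ∑ j, Q (ρ ![basis x i, basis x j])
    (η ![g.dualBasis x i, g.dualBasis x j])
  map_add' η η' := by simp [Finset.sum_add_distrib, mul_add]
  map_smul' c η := by
    simp only [AlternatingMap.smul_apply, map_smul, smul_eq_mul, RingHom.id_apply, ← Finset.mul_sum]
    ring

/-- The extension of the scalar product of two-forms to a `T`-valued pairing `(ρ, t η)` between a
`W`-valued two-form `ρ` and the `T ⊗ W`-valued two-form obtained by letting `t ∈ T ⊗ End(W)` act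
on `η`. On pure tensors, `(ρ, (v ⊗ A) η) = (ρ, A η) v`. -/
def tensorPairing {T : Type*} [AddCommGroup T] [Module ℝ T] (x : M) (Q : W →ₗ[ℝ] W →ₗ[ℝ] ℝ)
    (ρ η : TangentSpace (𝓡 4) x [⋀^Fin 2]→ₗ[ℝ] W) (t : T ⊗[ℝ] (W →ₗ[ℝ] W)) : T :=
  TensorProduct.rid ℝ T <| LinearMap.lTensor T
    (g.twoFormInner x Q ρ ∘ₗ
      { toFun := fun A : W →ₗ[ℝ] W ↦ A.compAlternatingMap η
        map_add' := fun _ _ ↦ rfl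
        map_smul' := fun _ _ ↦ rfl }) t

end LorentzianMetric

end Lorentzian

/-! ### Configurations, field equations and solutions -/

section FieldEquations

variable {E : Type*} [NormedAddCommGroup E] [NormedSpace ℝ E]
  {N : Type*} [TopologicalSpace N] [ChartedSpace E N] [IsManifold 𝓘(ℝ, E) ∞ N]
  {F : Type*} [NormedAddCommGroup F] [NormedSpace ℝ F]
  {S : N → Type*} [TopologicalSpace (TotalSpace F S)]
  [∀ y, AddCommGroup (S y)] [∀ y, Module ℝ (S y)] [∀ y, TopologicalSpace (S y)]
  [∀ y, IsTopologicalAddGroup (S y)] [∀ y, ContinuousSMul ℝ (S y)]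
  [FiberBundle F S] [VectorBundle ℝ F S] [ContMDiffVectorBundle ∞ F S 𝓘(ℝ, E)]
  {M : Type*} [TopologicalSpace M] [ChartedSpace (EuclideanSpace ℝ (Fin 4)) M] [IsManifold (𝓡 4) ∞ M]

variable (E F S M) in
/-- A smooth map `φ : M → N` together with a smooth `S^φ`-valued two-form `V ∈ Ω²(M, S^φ)`.
Smoothness of `V` means that `V(X, Y)` is a smooth section of `S^φ`, that is, a smooth map into
the total space of `S` which covers `φ`, for all smooth vector fields `X`, `Y`. -/
@[ext]
structure FieldPair where
  /-- the scalar map -/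
  φ : M → N
  contMDiff_φ : ContMDiff (𝓡 4) 𝓘(ℝ, E) ∞ φ
  /-- the two-form -/
  V (x : M) : TangentSpace (𝓡 4) x [⋀^Fin 2]→ₗ[ℝ] S (φ x)
  contMDiff_V (X Y : Π x : M, TangentSpace (𝓡 4) x)
    (hX : IsSmoothVectorField X) (hY : IsSmoothVectorField Y) :
    ContMDiff (𝓡 4) (𝓘(ℝ, E).prod 𝓘(ℝ, F)) ∞
      (fun x ↦ TotalSpace.mk' F (E := S) (φ x) (V x ![X x, Y x]))

section Tension

variable [FiniteDimensional ℝ E]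

/-- The second fundamental form `∇ dφ` of `φ`, for the connection induced by the Levi-Civita
connections of `g` and `G`: `(∇ dφ)(u, v) = ∇^φ_u (dφ Y) - dφ (∇_u Y)` for a vector field `Y` with
`Y x = v`. -/
def secondFundamentalForm (g : LorentzianMetric M) (G : PseudoRiemannianMetric E N) (φ : M → N)
    (x : M) (u v : TangentSpace (𝓡 4) x) : TangentSpace 𝓘(ℝ, E) (φ x) :=
  pullbackConnection E G.leviCivita φ
      (fun x' ↦ mfderiv (𝓡 4) 𝓘(ℝ, E) φ x' (extend (EuclideanSpace ℝ (Fin 4)) v x')) x u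
    - mfderiv (𝓡 4) 𝓘(ℝ, E) φ x (g.leviCivita (extend (EuclideanSpace ℝ (Fin 4)) v) x u)

/-- The tension field `Tr_g ∇ dφ`. -/
def tensionField (g : LorentzianMetric M) (G : PseudoRiemannianMetric E N) (φ : M → N) (x : M) :
    TangentSpace 𝓘(ℝ, E) (φ x) :=
  g.trace x (secondFundamentalForm g G φ x)

/-- The gradient of the scalar potential. -/
def ScalarStructure.grad (𝒮 : ScalarStructure E N) (y : N) : TangentSpace 𝓘(ℝ, E) y :=
  𝒮.metric.sharp y ((d% 𝒮.Φ) y).toLinearMap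

/-- The modified tension field `θ_G(g, φ) - (grad Φ)^φ`. -/
def modifiedTensionField (g : LorentzianMetric M)
    (𝒮 : ScalarStructure E N) (φ : M → N) (x : M) : TangentSpace 𝓘(ℝ, E) (φ x) :=
  tensionField g 𝒮.metric φ x - 𝒮.grad (φ x)

end Tension

namespace FieldPair

/-- Positive polarization: `⋆ V = V`, where `⋆ = ∗_g ∘ J^φ` is the twisted Hodge operator. -/
def IsPositivelyPolarized (c : FieldPair E F S M) (o : ManifoldOrientation M)
    (g : LorentzianMetric M) (Ξ : ElectromagneticStructure E F S) : Prop :=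
  ∀ x : M, g.hodge o x ((Ξ.J (c.φ x)).toLinearMap.compAlternatingMap (c.V x)) = c.V x

/-- The scalar equation `θ_Σ(g, φ) - ½ (∗ V, Ψ^φ V) = 0`. -/
def SolvesScalar [FiniteDimensional ℝ E] [FiniteDimensional ℝ F] (c : FieldPair E F S M)
    (o : ManifoldOrientation M) (g : LorentzianMetric M)
    (𝒟 : ScalarElectromagneticStructure E F S) : Prop :=
  ∀ x : M, modifiedTensionField g 𝒟.scalar c.φ x
    - (1 / 2 : ℝ) • g.tensorPairing x (𝒟.em.Q (c.φ x)) (g.hodge o x (c.V x)) (c.V x)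
        (𝒟.fundamentalField (c.φ x)) = 0

/-- The twisted electromagnetic equation `d_{D^φ} V = 0`. -/
def SolvesElectromagnetic (c : FieldPair E F S M) (Δ : DualityStructure E F S) : Prop :=
  ∀ X Y Z : Π x : M, TangentSpace (𝓡 4) x,
    IsSmoothVectorField X → IsSmoothVectorField Y → IsSmoothVectorField Z →
      ∀ x : M, twistedExtDeriv F Δ.D c.φ c.V X Y Z x = 0

end FieldPair

namespace ScalarElectromagneticStructure

variable (𝒟 : ScalarElectromagneticStructure E F S) (o : ManifoldOrientation M)
  (g : LorentzianMetric M)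

/-- The set `Conf^g_𝒟(M)` of global scalar-electromagnetic configurations relative to `g`. -/
def Conf : Set (FieldPair E F S M) := {c | c.IsPositivelyPolarized o g 𝒟.em}

/-- The set `Sol^g_𝒟(M)` of global scalar-electromagnetic solutions relative to `g`. -/
def Sol [FiniteDimensional ℝ E] [FiniteDimensional ℝ F] : Set (FieldPair E F S M) :=
  {c | c ∈ 𝒟.Conf o g ∧ c.SolvesScalar o g 𝒟 ∧ c.SolvesElectromagnetic 𝒟.em.toDualityStructure}

end ScalarElectromagneticStructure

end FieldEquations

/-! ### Unbased automorphisms -/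

section Automorphisms

variable {E : Type*} [NormedAddCommGroup E] [NormedSpace ℝ E]
  {N : Type*} [TopologicalSpace N] [ChartedSpace E N] [IsManifold 𝓘(ℝ, E) ∞ N]
  {F : Type*} [NormedAddCommGroup F] [NormedSpace ℝ F]
  {S : N → Type*} [TopologicalSpace (TotalSpace F S)]
  [∀ y, AddCommGroup (S y)] [∀ y, Module ℝ (S y)] [∀ y, TopologicalSpace (S y)]
  [∀ y, IsTopologicalAddGroup (S y)] [∀ y, ContinuousSMul ℝ (S y)]
  [FiberBundle F S] [VectorBundle ℝ F S] [ContMDiffVectorBundle ∞ F S 𝓘(ℝ, E)]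
  {M : Type*} [TopologicalSpace M] [ChartedSpace (EuclideanSpace ℝ (Fin 4)) M]
  [IsManifold (𝓡 4) ∞ M]

variable (E F S) in
/-- An unbased automorphism of the vector bundle `S`: a diffeomorphism of the total space which
covers a diffeomorphism `base` of the base and restricts to linear isomorphisms of the fibers. -/
structure UnbasedAut where
  /-- the projection `f₀` to the base -/
  base : N ≃ₘ⟮𝓘(ℝ, E), 𝓘(ℝ, E)⟯ N
  /-- the fiber maps; they constitute the based isomorphism `f̂ : S → S^{f₀}` -/
  fiber (y : N) : S y ≃L[ℝ] S (base y)
  /-- the diffeomorphism of the total space -/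
  total : TotalSpace F S ≃ₘ⟮𝓘(ℝ, E).prod 𝓘(ℝ, F), 𝓘(ℝ, E).prod 𝓘(ℝ, F)⟯ TotalSpace F S
  total_mk (y : N) (s : S y) : total ⟨y, s⟩ = ⟨base y, fiber y s⟩

namespace UnbasedAut

/-- Transport along an equality of base points. -/
def fiberCast {y z : N} (h : y = z) : S y ≃L[ℝ] S z := by
  subst h
  exact ContinuousLinearEquiv.refl ℝ (S y)

lemma mk_fiberCast {y z : N} (h : y = z) (s : S y) :
    (⟨z, fiberCast h s⟩ : TotalSpace F S) = ⟨y, s⟩ := by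
  subst h
  rfl

lemma mk_section (σ : Π y : N, S y) {y z : N} (h : y = z) :
    (⟨y, σ y⟩ : TotalSpace F S) = ⟨z, σ z⟩ := by
  subst h
  rfl

@[ext] lemma ext {f f' : UnbasedAut E F S} (h : ∀ p, f.total p = f'.total p) : f = f' := by
  obtain ⟨b, φ, t, ht⟩ := f
  obtain ⟨b', φ', t', ht'⟩ := f'
  obtain rfl : t = t' := Diffeomorph.ext h
  obtain rfl : b = b' := Diffeomorph.ext fun y ↦ by
    simpa [ht] using congr_arg TotalSpace.proj (ht' y 0)
  obtain rfl : φ = φ' := by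
    funext y
    ext s
    simpa [ht] using ht' y s
  rfl

instance : Mul (UnbasedAut E F S) where
  mul f f' :=
    { base := f'.base.trans f.base
      fiber := fun y ↦ (f'.fiber y).trans (f.fiber (f'.base y))
      total := f'.total.trans f.total
      total_mk := fun y s ↦ by simp [total_mk]; rfl }

instance : One (UnbasedAut E F S) where
  one :=
    { base := Diffeomorph.refl _ _ _
      fiber := fun y ↦ ContinuousLinearEquiv.refl ℝ (S y)
      total := Diffeomorph.refl _ _ _
      total_mk := fun _ _ ↦ rfl }

instance : Inv (UnbasedAut E F S) where
  inv f :=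
    { base := f.base.symm
      fiber := fun y ↦ (fiberCast (f.base.apply_symm_apply y).symm).trans
        (f.fiber (f.base.symm y)).symm
      total := f.total.symm
      total_mk := fun y s ↦ by
        apply f.total.injective
        simp [total_mk, mk_fiberCast] }

lemma total_mul (f f' : UnbasedAut E F S) (p : TotalSpace F S) :
    (f * f').total p = f.total (f'.total p) := rfl

lemma total_one (p : TotalSpace F S) : (1 : UnbasedAut E F S).total p = p := rfl

lemma total_inv (f : UnbasedAut E F S) (p : TotalSpace F S) : f⁻¹.total p = f.total.symm p := rfl

/-- The group of unbased automorphisms, under composition. -/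
instance : Group (UnbasedAut E F S) where
  mul_assoc _ _ _ := by ext1 p; rfl
  one_mul _ := by ext1 p; rfl
  mul_one _ := by ext1 p; rfl
  inv_mul_cancel f := by ext1 p; simp [total_mul, total_inv, total_one]

@[simp] lemma base_mul (f f' : UnbasedAut E F S) (y : N) :
    (f * f').base y = f.base (f'.base y) := rfl

@[simp] lemma base_one (y : N) : (1 : UnbasedAut E F S).base y = y := rfl

@[simp] lemma base_inv (f : UnbasedAut E F S) (y : N) : f⁻¹.base y = f.base.symm y := rfl

@[simp] lemma fiber_mul (f f' : UnbasedAut E F S) (y : N) (s : S y) :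
    (f * f').fiber y s = f.fiber (f'.base y) (f'.fiber y s) := rfl

@[simp] lemma fiber_one (y : N) (s : S y) : (1 : UnbasedAut E F S).fiber y s = s := rfl

lemma fiber_fiber_inv (f : UnbasedAut E F S) (y : N) (s : S y) :
    f.fiber (f.base.symm y) (f⁻¹.fiber y s) = fiberCast (f.base.apply_symm_apply y).symm s :=
  (f.fiber (f.base.symm y)).apply_symm_apply _

/-- `f` is symplectic. -/
def IsSymplectic (f : UnbasedAut E F S) (Δ : DualityStructure E F S) : Prop :=
  ∀ (y : N) (s t : S y), Δ.symp (f.base y) (f.fiber y s) (f.fiber y t) = Δ.symp y s t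

/-- `f` is covariantly constant: whenever `τ = f ∘ σ ∘ f₀⁻¹` is the image under `f` of a section
`σ`, then `D_{df₀ u} τ = f (D_u σ)`. -/
def IsCovariantlyConstant (f : UnbasedAut E F S) (Δ : DualityStructure E F S) : Prop :=
  ∀ σ τ : Π y : N, S y, (∀ y, τ (f.base y) = f.fiber y (σ y)) →
    ∀ y : N, MDiffAt (T% σ) y → ∀ u : TangentSpace 𝓘(ℝ, E) y,
      Δ.D τ (f.base y) (mfderiv 𝓘(ℝ, E) 𝓘(ℝ, E) f.base y u) = f.fiber y (Δ.D σ y u)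

/-- The adjoint action `Ad(f)(J) = f ∘ J ∘ f⁻¹` on sections of `End(S)`. -/
def Ad (f : UnbasedAut E F S) (J : Π y : N, S y →L[ℝ] S y) (y : N) : S y →L[ℝ] S y :=
  let e : S (f.base.symm y) ≃L[ℝ] S y :=
    (f.fiber (f.base.symm y)).trans (fiberCast (f.base.apply_symm_apply y))
  (e : S (f.base.symm y) →L[ℝ] S y) ∘L J (f.base.symm y) ∘L (e.symm : S y →L[ℝ] S (f.base.symm y))

/-- `Ad(f)(J) = J'` if and only if `f ∘ J = J' ∘ f`. -/
lemma Ad_eq_iff (f : UnbasedAut E F S) (J J' : Π y : N, S y →L[ℝ] S y) :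
    f.Ad J = J' ↔ ∀ (y : N) (s : S y), f.fiber y (J y s) = J' (f.base y) (f.fiber y s) := by
  have key : ∀ (y x : N) (hx : x = f.base.symm y) (h : f.base x = y) (s : S x),
      f.Ad J y (fiberCast h (f.fiber x s)) = fiberCast h (f.fiber x (J x s)) := by
    rintro y x rfl h s
    simp [Ad]
  have key' (y : N) (s : S y) : f.Ad J (f.base y) (f.fiber y s) = f.fiber y (J y s) :=
    key (f.base y) y (f.base.symm_apply_apply y).symm rfl s
  constructor
  · rintro rfl y s
    exact (key' y s).symm
  · intro h
    funext z
    obtain ⟨y, rfl⟩ := f.base.surjective z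
    ext t
    obtain ⟨s, rfl⟩ := (f.fiber y).surjective t
    exact (key' y s).trans (h y s)

lemma total_section_iff (f : UnbasedAut E F S) (σ τ : Π y : N, S y) :
    (∀ y, τ (f.base y) = f.fiber y (σ y)) ↔ ∀ y, f.total ⟨y, σ y⟩ = ⟨f.base y, τ (f.base y)⟩ := by
  refine forall_congr' fun y ↦ ?_
  rw [total_mk]
  simp [eq_comm]

lemma mdifferentiableAt_image {f : UnbasedAut E F S} {σ τ : Π y : N, S y}
    (h : ∀ y, τ (f.base y) = f.fiber y (σ y)) {y : N} (hσ : MDiffAt (T% σ) y) :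
    MDiffAt (T% τ) (f.base y) := by
  have e : (T% τ) = f.total ∘ (T% σ) ∘ f.base.symm := by
    funext z
    obtain ⟨y, rfl⟩ := f.base.surjective z
    change _ = f.total ⟨_, σ (f.base.symm (f.base y))⟩
    rw [mk_section σ (f.base.symm_apply_apply y)]
    exact ((f.total_section_iff σ τ).1 h y).symm
  rw [e]
  refine (f.total.contMDiff.mdifferentiableAt (by simp)).comp _ ?_
  refine MDifferentiableAt.comp _ ?_ (f.base.symm.contMDiff.mdifferentiableAt (by simp))
  simpa using hσ

lemma exists_image (f : UnbasedAut E F S) (σ : Π y : N, S y) :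
    ∃ τ : Π y : N, S y, ∀ y, τ (f.base y) = f.fiber y (σ y) := by
  let τ : Π y : N, S y := fun y ↦ fiberCast (f.base.apply_symm_apply y)
    (f.fiber (f.base.symm y) (σ (f.base.symm y)))
  refine ⟨τ, (f.total_section_iff σ τ).2 fun y ↦ ?_⟩
  change _ = (⟨_, fiberCast _ _⟩ : TotalSpace F S)
  rw [mk_fiberCast, ← total_mk, mk_section σ (f.base.symm_apply_apply y)]

lemma mfderiv_base_mul (f f' : UnbasedAut E F S) (y : N) (u : TangentSpace 𝓘(ℝ, E) y) :
    mfderiv 𝓘(ℝ, E) 𝓘(ℝ, E) (f * f').base y u =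
      mfderiv 𝓘(ℝ, E) 𝓘(ℝ, E) f.base (f'.base y) (mfderiv 𝓘(ℝ, E) 𝓘(ℝ, E) f'.base y u) :=
  congr($(mfderiv_comp y (f.base.contMDiff.mdifferentiableAt (by simp))
    (f'.base.contMDiff.mdifferentiableAt (by simp))) u)

lemma mfderiv_base_inv (f : UnbasedAut E F S) (y : N) (u : TangentSpace 𝓘(ℝ, E) y) :
    mfderiv 𝓘(ℝ, E) 𝓘(ℝ, E) f.base (f.base.symm y)
      (mfderiv 𝓘(ℝ, E) 𝓘(ℝ, E) f⁻¹.base y u) = u := by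
  have e := mfderiv_comp y (f.base.contMDiff.mdifferentiableAt (by simp))
    (f.base.symm.contMDiff.mdifferentiableAt (x := y) (by simp) :
      MDifferentiableAt 𝓘(ℝ, E) 𝓘(ℝ, E) f.base.symm y)
  have e' : f.base ∘ f.base.symm = id := funext f.base.apply_symm_apply
  rw [e', mfderiv_id] at e
  exact congr($e.symm u)

lemma IsCovariantlyConstant.mul {f f' : UnbasedAut E F S} {Δ : DualityStructure E F S}
    (hf : f.IsCovariantlyConstant Δ) (hf' : f'.IsCovariantlyConstant Δ) :
    (f * f').IsCovariantlyConstant Δ := by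
  intro σ τ h y hσ u
  obtain ⟨ρ, hρ⟩ := f'.exists_image σ
  have hτ : ∀ y, τ (f.base y) = f.fiber y (ρ y) := fun z ↦ by
    obtain ⟨y, rfl⟩ := f'.base.surjective z
    exact (h y).trans congr(f.fiber _ $(hρ y)).symm
  have e := hf ρ τ hτ (f'.base y) (mdifferentiableAt_image hρ hσ)
    (mfderiv 𝓘(ℝ, E) 𝓘(ℝ, E) f'.base y u)
  rw [hf' σ ρ hρ y hσ u, ← mfderiv_base_mul] at e
  exact e

lemma IsCovariantlyConstant.inv {f : UnbasedAut E F S} {Δ : DualityStructure E F S}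
    (hf : f.IsCovariantlyConstant Δ) : f⁻¹.IsCovariantlyConstant Δ := by
  intro σ τ h y hσ u
  have hτ : ∀ z, σ (f.base z) = f.fiber z (τ z) := by
    rw [total_section_iff] at h ⊢
    intro z
    have := h (f.base z)
    rw [base_inv, mk_section τ (f.base.symm_apply_apply z)] at this
    rw [← this, total_inv, Diffeomorph.apply_symm_apply]
  have cast (y' : N) (hy : y' = y) (w : E) :
      fiberCast hy.symm (Δ.D σ y (w : TangentSpace 𝓘(ℝ, E) y))
        = Δ.D σ y' (w : TangentSpace 𝓘(ℝ, E) y') := by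
    subst hy
    rfl
  have hd : MDiffAt (T% τ) (f.base.symm y) := mdifferentiableAt_image (f := f⁻¹) h hσ
  have e := hf τ σ hτ (f.base.symm y) hd (mfderiv 𝓘(ℝ, E) 𝓘(ℝ, E) f⁻¹.base y u)
  rw [mfderiv_base_inv] at e
  refine (f.fiber (f.base.symm y)).injective (e.symm.trans ?_)
  refine (cast _ (f.base.apply_symm_apply y) u).symm.trans ?_
  exact ((f.fiber (f.base.symm y)).apply_symm_apply _).symm

end UnbasedAut

/-- The group `Aut^ub(Δ)` of symmetries of a duality structure. -/
def DualityStructure.Aut (Δ : DualityStructure E F S) : Subgroup (UnbasedAut E F S) where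
  carrier := {f | f.IsSymplectic Δ ∧ f.IsCovariantlyConstant Δ}
  one_mem' := by
    refine ⟨fun y s t ↦ rfl, fun σ τ h y hσ u ↦ ?_⟩
    obtain rfl : τ = σ := funext h
    exact congr(Δ.D τ y ($(mfderiv_id) u))
  mul_mem' := by
    rintro f f' ⟨h1, h2⟩ ⟨h1', h2'⟩
    exact ⟨fun y s t ↦ (h1 _ _ _).trans (h1' _ _ _), h2.mul h2'⟩
  inv_mem' := by
    rintro f ⟨h1, h2⟩
    refine ⟨fun y s t ↦ ?_, h2.inv⟩
    refine (h1 (f.base.symm y) (f⁻¹.fiber y s) (f⁻¹.fiber y t)).symm.trans ?_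
    rw [UnbasedAut.fiber_fiber_inv, UnbasedAut.fiber_fiber_inv]
    have key (y' : N) (hy : y = y') (s t : S y) :
        Δ.symp y' (UnbasedAut.fiberCast hy s) (UnbasedAut.fiberCast hy t) = Δ.symp y s t := by
      subst hy
      rfl
    exact key _ _ s t

/-- The group `Aut(Σ)` of isometries of the scalar manifold which preserve the scalar potential, as
a predicate on diffeomorphisms. -/
def ScalarStructure.IsAut (𝒮 : ScalarStructure E N) (ψ : N ≃ₘ⟮𝓘(ℝ, E), 𝓘(ℝ, E)⟯ N) : Prop :=
  (∀ (y : N) (u v : TangentSpace 𝓘(ℝ, E) y),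
    𝒮.G.inner (ψ y) (mfderiv 𝓘(ℝ, E) 𝓘(ℝ, E) ψ y u) (mfderiv 𝓘(ℝ, E) 𝓘(ℝ, E) ψ y v) =
      𝒮.G.inner y u v) ∧
  ∀ y : N, 𝒮.Φ (ψ y) = 𝒮.Φ y

namespace ScalarElectromagneticStructure

variable (𝒟 : ScalarElectromagneticStructure E F S)

/-- The scalar-electromagnetic duality group `Aut(𝒟₀)`. -/
def dualityGroup : Subgroup (UnbasedAut E F S) where
  carrier := {f | f ∈ 𝒟.em.toDualityStructure.Aut ∧ 𝒟.scalar.IsAut f.base}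
  one_mem' := ⟨one_mem _, fun y u v ↦ congr(𝒟.scalar.G.inner y ($(mfderiv_id) u) ($(mfderiv_id) v)),
    fun y ↦ rfl⟩
  mul_mem' := by
    rintro f f' ⟨h, h1, h2⟩ ⟨h', h1', h2'⟩
    refine ⟨mul_mem h h', fun y u v ↦ ?_, fun y ↦ (h2 _).trans (h2' _)⟩
    rw [UnbasedAut.mfderiv_base_mul, UnbasedAut.mfderiv_base_mul]
    exact (h1 _ _ _).trans (h1' _ _ _)
  inv_mem' := by
    rintro f ⟨h, h1, h2⟩
    refine ⟨inv_mem h, fun y u v ↦ ?_, fun y ↦ ?_⟩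
    · refine (h1 (f.base.symm y) (mfderiv 𝓘(ℝ, E) 𝓘(ℝ, E) f⁻¹.base y u)
        (mfderiv 𝓘(ℝ, E) 𝓘(ℝ, E) f⁻¹.base y v)).symm.trans ?_
      rw [UnbasedAut.mfderiv_base_inv, UnbasedAut.mfderiv_base_inv]
      have key (y' : N) (hy : y' = y) (u v : E) :
          𝒟.scalar.G.inner y' (u : TangentSpace 𝓘(ℝ, E) y') (v : TangentSpace 𝓘(ℝ, E) y') =
            𝒟.scalar.G.inner y (u : TangentSpace 𝓘(ℝ, E) y) (v : TangentSpace 𝓘(ℝ, E) y) := by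
        subst hy
        rfl
      exact key _ (f.base.apply_symm_apply y) u v
    · refine (h2 (f.base.symm y)).symm.trans ?_
      rw [Diffeomorph.apply_symm_apply]

/-- The scalar-electromagnetic symmetry group `Aut(𝒟)`: the dualities `f` with `Ad(f)(J) = J`. -/
def symmetryGroup : Subgroup (UnbasedAut E F S) where
  carrier := {f | f ∈ 𝒟.dualityGroup ∧ f.Ad 𝒟.em.J = 𝒟.em.J}
  one_mem' := ⟨one_mem _, (UnbasedAut.Ad_eq_iff _ _ _).2 fun _ _ ↦ rfl⟩
  mul_mem' := by
    rintro f f' ⟨h, h1⟩ ⟨h', h1'⟩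
    rw [UnbasedAut.Ad_eq_iff] at h1 h1'
    refine ⟨mul_mem h h', (UnbasedAut.Ad_eq_iff _ _ _).2 fun y s ↦ ?_⟩
    rw [UnbasedAut.fiber_mul, h1', h1]
    rfl
  inv_mem' := by
    rintro f ⟨h, h1⟩
    rw [UnbasedAut.Ad_eq_iff] at h1
    refine ⟨inv_mem h, (UnbasedAut.Ad_eq_iff _ _ _).2 fun y s ↦ ?_⟩
    apply (f.fiber (f.base.symm y)).injective
    refine (f.fiber_fiber_inv y _).trans (Eq.trans ?_ (h1 (f.base.symm y) (f⁻¹.fiber y s)).symm)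
    rw [UnbasedAut.fiber_fiber_inv]
    have key (y' : N) (hy : y = y') (s : S y) :
        UnbasedAut.fiberCast hy (𝒟.em.J y s) = 𝒟.em.J y' (UnbasedAut.fiberCast hy s) := by
      subst hy
      rfl
    exact key _ _ s

end ScalarElectromagneticStructure

/-- The duality action `f ⋄ (φ, V) = (f₀ ∘ φ, f̂^φ(V))`. -/
instance : MulAction (UnbasedAut E F S) (FieldPair E F S M) where
  smul f c :=
    { φ := f.base ∘ c.φ
      contMDiff_φ := f.base.contMDiff.comp c.contMDiff_φ
      V := fun x ↦ (f.fiber (c.φ x)).toLinearEquiv.toLinearMap.compAlternatingMap (c.V x)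
      contMDiff_V := fun X Y hX hY ↦ by
        convert f.total.contMDiff.comp (c.contMDiff_V X Y hX hY) using 1
        funext x
        exact (f.total_mk _ _).symm }
  one_smul _ := rfl
  mul_smul _ _ _ := rfl

end Automorphisms

end ESM

end

/-!
Each ingredient of the field equations (the Levi-Civita connections, the gradient of the potential,
the fundamental field, the pulled-back connections, the Hodge operator) is natural under an
isomorphism `f` of scalar-electromagnetic structures. Hence the left-hand side of the scalar
equation for `f • c` is the image under `df₀` of the one for `c`, and the left-hand sides of the
electromagnetic equation and of the polarization condition are images under `f`. These maps are
injective, so each equation holds for `f • c` if and only if it holds for `c`.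

The naturality of the pulled-back connection is the only point that is not pointwise. A section
along `φ` need not be the pullback of a section, but near a point it is a combination
`∑ aᵢ • (σᵢ ∘ φ)` of pulled-back ones with scalar coefficients `aᵢ`, which the Leibniz rule reduces
to the defining property of `f` on sections.
-/

noncomputable section

namespace ESM

section CoordAlong

variable {N : Type*} [TopologicalSpace N]
  {F : Type*} [NormedAddCommGroup F]
  {S : N → Type*} [TopologicalSpace (TotalSpace F S)] [∀ y, TopologicalSpace (S y)]
  [FiberBundle F S] {M : Type*}

variable (F) in
/-- The coordinate representation, around `x`, of a section `s` along `φ` in the preferred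
trivialization at `φ x`: it is the map differentiated in `pullbackConnection`. -/
def coordAlong (φ : M → N) (s : Π x : M, S (φ x)) (x x' : M) : F :=
  (trivializationAt F S (φ x) ⟨φ x', s x'⟩).2

section

variable [NormedSpace ℝ F] [∀ y, AddCommGroup (S y)] [∀ y, Module ℝ (S y)] [VectorBundle ℝ F S]

lemma symmL_coordAlong_self {φ : M → N} (s : Π x : M, S (φ x)) (x : M) :
    (trivializationAt F S (φ x)).symmL ℝ (φ x) (coordAlong F φ s x x) = s x := by
  rw [Trivialization.symmL_apply _ (mem_baseSet_trivializationAt F S (φ x))]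
  exact extend_apply_self (F := F) (s x)

lemma extend_eq_symmL {y z : N} (hz : z ∈ (trivializationAt F S y).baseSet) (s : S y) :
    extend F s z = (trivializationAt F S y).symmL ℝ z
      ((trivializationAt F S y).continuousLinearEquivAt ℝ y
        (mem_baseSet_trivializationAt F S y) s) := by
  rw [Trivialization.symmL_apply _ hz]
  rfl

end

variable [TopologicalSpace M] {φ : M → N} {x : M}

lemma eventually_mem_baseSet (hφ : ContinuousAt φ x) :
    ∀ᶠ x' in 𝓝 x, φ x' ∈ (trivializationAt F S (φ x)).baseSet :=
  hφ ((trivializationAt F S (φ x)).open_baseSet.mem_nhds (mem_baseSet_trivializationAt F S (φ x)))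

lemma coordAlong_congr {s t : Π x : M, S (φ x)} (h : ∀ᶠ x' in 𝓝 x, s x' = t x') :
    coordAlong F φ s x =ᶠ[𝓝 x] coordAlong F φ t x :=
  h.mono fun x' hx' ↦ by rw [coordAlong, coordAlong, hx']

lemma coordAlong_extend [∀ y, Zero (S y)] (hφ : ContinuousAt φ x) (s : S (φ x)) :
    coordAlong F φ (fun x' ↦ extend F s (φ x')) x =ᶠ[𝓝 x]
      fun _ ↦ (trivializationAt F S (φ x) ⟨φ x, s⟩).2 := by
  filter_upwards [eventually_mem_baseSet (F := F) (S := S) hφ] with x' hx'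
  exact congr($((trivializationAt F S (φ x)).apply_mk_symm hx' _).2)

variable [NormedSpace ℝ F] [∀ y, AddCommGroup (S y)] [∀ y, Module ℝ (S y)] [VectorBundle ℝ F S]

lemma coordAlong_zero (hφ : ContinuousAt φ x) : coordAlong F (S := S) φ 0 x =ᶠ[𝓝 x] 0 :=
  (eventually_mem_baseSet hφ).mono fun _ hx' ↦
    ((trivializationAt F S (φ x)).linear ℝ hx').mk'.map_zero

lemma coordAlong_add (hφ : ContinuousAt φ x) (s t : Π x : M, S (φ x)) :
    coordAlong F φ (s + t) x =ᶠ[𝓝 x] coordAlong F φ s x + coordAlong F φ t x :=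
  (eventually_mem_baseSet hφ).mono fun x' hx' ↦
    ((trivializationAt F S (φ x)).linear ℝ hx').map_add (s x') (t x')

lemma coordAlong_smul (hφ : ContinuousAt φ x) (a : M → ℝ) (s : Π x : M, S (φ x)) :
    coordAlong F φ (a • s) x =ᶠ[𝓝 x] a • coordAlong F φ s x :=
  (eventually_mem_baseSet hφ).mono fun x' hx' ↦
    ((trivializationAt F S (φ x)).linear ℝ hx').map_smul (a x') (s x')

end CoordAlong

section PullbackConnection

variable {E : Type*} [NormedAddCommGroup E] [NormedSpace ℝ E]
  {N : Type*} [TopologicalSpace N] [ChartedSpace E N]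
  {F : Type*} [NormedAddCommGroup F] [NormedSpace ℝ F]
  {S : N → Type*} [TopologicalSpace (TotalSpace F S)] [∀ y, TopologicalSpace (S y)]
  [FiberBundle F S]
  {E' : Type*} [NormedAddCommGroup E'] [NormedSpace ℝ E']
  {M : Type*} [TopologicalSpace M] [ChartedSpace E' M]

lemma mvfderiv_congr {V : Type*} [NormedAddCommGroup V] [NormedSpace ℝ V] {a b : M → V} {x : M}
    (h : a =ᶠ[𝓝 x] b) : (d% a) x = (d% b) x := by
  ext u
  exact congr($(h.mfderiv_eq (I := 𝓘(ℝ, E')) (I' := 𝓘(ℝ, V))) u)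

variable (E F E') in
/-- Differentiability at `x` of a section `s` along `φ`, as a map to the total space. -/
def MDifferentiableAlongAt (φ : M → N) (s : Π x : M, S (φ x)) (x : M) : Prop :=
  MDifferentiableAt 𝓘(ℝ, E') (𝓘(ℝ, E).prod 𝓘(ℝ, F)) (fun x' ↦ TotalSpace.mk' F (φ x') (s x')) x

lemma mdifferentiableAlongAt_iff {φ : M → N} {s : Π x : M, S (φ x)} {x : M} :
    MDifferentiableAlongAt E F E' φ s x ↔
      MDifferentiableAt 𝓘(ℝ, E') 𝓘(ℝ, E) φ x ∧ MDiffAt (coordAlong F φ s x) x :=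
  mdifferentiableAt_totalSpace _ _

variable [∀ y, AddCommGroup (S y)] [∀ y, Module ℝ (S y)] [VectorBundle ℝ F S]

lemma MDifferentiableAlongAt.add {φ : M → N} {s t : Π x : M, S (φ x)} {x : M}
    (hs : MDifferentiableAlongAt E F E' φ s x) (ht : MDifferentiableAlongAt E F E' φ t x) :
    MDifferentiableAlongAt E F E' φ (s + t) x := by
  obtain ⟨hφ, hs⟩ := mdifferentiableAlongAt_iff.1 hs
  obtain ⟨-, ht⟩ := mdifferentiableAlongAt_iff.1 ht
  exact mdifferentiableAlongAt_iff.2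
    ⟨hφ, (hs.add ht).congr_of_eventuallyEq (coordAlong_add hφ.continuousAt _ _)⟩

lemma MDifferentiableAlongAt.smul {φ : M → N} {a : M → ℝ} {s : Π x : M, S (φ x)} {x : M}
    (ha : MDiffAt a x) (hs : MDifferentiableAlongAt E F E' φ s x) :
    MDifferentiableAlongAt E F E' φ (a • s) x := by
  obtain ⟨hφ, hs⟩ := mdifferentiableAlongAt_iff.1 hs
  exact mdifferentiableAlongAt_iff.2
    ⟨hφ, (ha.smul hs).congr_of_eventuallyEq (coordAlong_smul hφ.continuousAt _ _)⟩

lemma MDifferentiableAlongAt.sum {φ : M → N} {x : M} (hφ : MDifferentiableAt 𝓘(ℝ, E') 𝓘(ℝ, E) φ x)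
    {ι : Type*} {I : Finset ι} {s : ι → Π x : M, S (φ x)}
    (hs : ∀ i ∈ I, MDifferentiableAlongAt E F E' φ (s i) x) :
    MDifferentiableAlongAt E F E' φ (∑ i ∈ I, s i) x :=
  Finset.sum_induction s (MDifferentiableAlongAt E F E' φ · x) (fun _ _ ↦ .add)
    (mdifferentiableAlongAt_iff.2
      ⟨hφ, mdifferentiableAt_const.congr_of_eventuallyEq (coordAlong_zero hφ.continuousAt)⟩) hs

lemma exists_frame_expansion [FiniteDimensional ℝ F] [ContMDiffVectorBundle ∞ F S 𝓘(ℝ, E)]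
    {φ : M → N} {s : Π x : M, S (φ x)} {x : M} (hs : MDifferentiableAlongAt E F E' φ s x) :
    ∃ (a : Fin (finrank ℝ F) → M → ℝ) (σ : Fin (finrank ℝ F) → Π y : N, S y),
      (∀ i, MDiffAt (a i) x) ∧ (∀ i, MDiffAt (T% (σ i)) (φ x)) ∧
      ∀ᶠ x' in 𝓝 x, s x' = ∑ i, a i x' • σ i (φ x') := by
  obtain ⟨hφ, hs⟩ := mdifferentiableAlongAt_iff.1 hs
  let b := finBasis ℝ F
  let e := trivializationAt F S (φ x)
  refine ⟨fun i x' ↦ b.repr (coordAlong F φ s x x') i, fun i ↦ e.localFrame b i, fun i ↦ ?_,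
    fun i ↦ ?_, ?_⟩
  · exact (b.coord i).toContinuousLinearMap.differentiableAt.mdifferentiableAt.comp x hs
  · exact (contMDiffAt_localFrame_of_mem 1 e b i
      (mem_baseSet_trivializationAt' (φ x))).mdifferentiableAt (by simp)
  · filter_upwards [eventually_mem_baseSet (S := S) (F := F) hφ.continuousAt] with x' hx'
    have hframe (i) : e.localFrame b i (φ x') = e.symmₗ ℝ (φ x') (b i) := by
      rw [e.localFrame_apply_of_mem_baseSet b hx', e.symmₗ_apply hx']
      simp [Trivialization.basisAt]
    simp only [hframe, ← map_smul, ← map_sum, b.sum_repr]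
    rw [e.coe_symmₗ (R := ℝ) hx']
    simp [coordAlong, e, hx']

variable [∀ y, IsTopologicalAddGroup (S y)] [∀ y, ContinuousSMul ℝ (S y)]

/-- `f` intertwines the connections `D` and `D'`: whenever `τ = f ∘ σ ∘ f₀⁻¹` is the image under `f`
of a section `σ`, then `D'_{df₀ u} τ = f (D_u σ)`. -/
def UnbasedAut.Intertwines (f : UnbasedAut E F S) (D D' : CovariantDerivative 𝓘(ℝ, E) F S) : Prop :=
  ∀ σ τ : Π y : N, S y, (∀ y, τ (f.base y) = f.fiber y (σ y)) →
    ∀ y : N, MDiffAt (T% σ) y → ∀ u : TangentSpace 𝓘(ℝ, E) y,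
      D' τ (f.base y) (mfderiv 𝓘(ℝ, E) 𝓘(ℝ, E) f.base y u) = f.fiber y (D σ y u)

/-- The connection form of `D` at `y`, in the preferred trivialization at `y`. -/
def connectionForm (D : CovariantDerivative 𝓘(ℝ, E) F S) (y : N) :
    S y →ₗ[ℝ] TangentSpace 𝓘(ℝ, E) y →L[ℝ] S y where
  toFun s := D (extend F s) y
  map_add' s t := by
    have hs := mdifferentiableAt_extend 𝓘(ℝ, E) F s
    have ht := mdifferentiableAt_extend 𝓘(ℝ, E) F t
    rw [← D.isCovariantDerivativeOn.add hs ht]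
    refine D.isCovariantDerivativeOn.congr_of_eventuallyEq (mdifferentiableAt_extend ..)
      (mdifferentiableAt_add_section hs ht) Filter.univ_mem ?_
    filter_upwards [eventually_mem_baseSet (F := F) (S := S) (continuousAt_id (x := y))] with z hz
    exact (extend_eq_symmL hz (s + t)).trans <| by
      rw [Pi.add_apply, map_add, map_add]
      exact congr($(extend_eq_symmL hz s) + $(extend_eq_symmL hz t)).symm
  map_smul' a s := by
    have hs := mdifferentiableAt_extend 𝓘(ℝ, E) F s
    rw [RingHom.id_apply, ← D.isCovariantDerivativeOn.smul_const a hs]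
    refine D.isCovariantDerivativeOn.congr_of_eventuallyEq (mdifferentiableAt_extend ..)
      (mdifferentiableAt_const.smul_section hs) Filter.univ_mem ?_
    filter_upwards [eventually_mem_baseSet (F := F) (S := S) (continuousAt_id (x := y))] with z hz
    exact (extend_eq_symmL hz (a • s)).trans <| by
      rw [Pi.smul_apply, map_smul, map_smul]
      exact congr(a • $(extend_eq_symmL hz s)).symm

lemma pullbackConnection_eq (D : CovariantDerivative 𝓘(ℝ, E) F S) (φ : M → N)
    (s : Π x : M, S (φ x)) (x : M) (u : TangentSpace 𝓘(ℝ, E') x) :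
    pullbackConnection F D φ s x u =
      (trivializationAt F S (φ x)).symmL ℝ (φ x) ((d% (coordAlong F φ s x)) x u) +
        connectionForm D (φ x) (s x) (mfderiv 𝓘(ℝ, E') 𝓘(ℝ, E) φ x u) := by
  rw [Trivialization.symmL_apply _ (mem_baseSet_trivializationAt F S (φ x))]
  rfl

lemma pullbackConnection_congr (D : CovariantDerivative 𝓘(ℝ, E) F S) {φ : M → N}
    {s t : Π x : M, S (φ x)} {x : M} (h : ∀ᶠ x' in 𝓝 x, s x' = t x')
    (u : TangentSpace 𝓘(ℝ, E') x) :
    pullbackConnection F D φ s x u = pullbackConnection F D φ t x u := by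
  rw [pullbackConnection_eq, pullbackConnection_eq, mvfderiv_congr (coordAlong_congr h),
    h.self_of_nhds]

lemma pullbackConnection_add (D : CovariantDerivative 𝓘(ℝ, E) F S) {φ : M → N}
    {s t : Π x : M, S (φ x)} {x : M} (hs : MDifferentiableAlongAt E F E' φ s x)
    (ht : MDifferentiableAlongAt E F E' φ t x) (u : TangentSpace 𝓘(ℝ, E') x) :
    pullbackConnection F D φ (s + t) x u =
      pullbackConnection F D φ s x u + pullbackConnection F D φ t x u := by
  obtain ⟨hφ, hs⟩ := mdifferentiableAlongAt_iff.1 hs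
  obtain ⟨-, ht⟩ := mdifferentiableAlongAt_iff.1 ht
  simp only [pullbackConnection_eq, mvfderiv_congr (coordAlong_add hφ.continuousAt s t),
    mvfderiv_add hs ht, add_apply, Pi.add_apply, map_add]
  abel

lemma pullbackConnection_smul (D : CovariantDerivative 𝓘(ℝ, E) F S) {φ : M → N} {a : M → ℝ}
    {s : Π x : M, S (φ x)} {x : M} (ha : MDiffAt a x)
    (hs : MDifferentiableAlongAt E F E' φ s x) (u : TangentSpace 𝓘(ℝ, E') x) :
    pullbackConnection F D φ (a • s) x u =
      a x • pullbackConnection F D φ s x u + (d% a) x u • s x := by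
  obtain ⟨hφ, hs⟩ := mdifferentiableAlongAt_iff.1 hs
  simp only [pullbackConnection_eq, mvfderiv_congr (coordAlong_smul hφ.continuousAt a s),
    mvfderiv_smul ha hs, add_apply, smul_apply, ContinuousLinearMap.smulRight_apply, map_add,
    map_smul, symmL_coordAlong_self, Pi.smul_apply', smul_add]
  module

lemma pullbackConnection_sum (D : CovariantDerivative 𝓘(ℝ, E) F S) {φ : M → N} {x : M}
    (hφ : MDifferentiableAt 𝓘(ℝ, E') 𝓘(ℝ, E) φ x) {ι : Type*} {I : Finset ι}
    {s : ι → Π x : M, S (φ x)} (hs : ∀ i ∈ I, MDifferentiableAlongAt E F E' φ (s i) x)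
    (u : TangentSpace 𝓘(ℝ, E') x) :
    pullbackConnection F D φ (∑ i ∈ I, s i) x u = ∑ i ∈ I, pullbackConnection F D φ (s i) x u := by
  classical
  induction I using Finset.induction_on with
  | empty =>
    rw [Finset.sum_empty, Finset.sum_empty, pullbackConnection_eq,
      mvfderiv_congr (coordAlong_zero hφ.continuousAt), mvfderiv_zero]
    simp
  | insert j I hj ih =>
    have hI : ∀ i ∈ I, MDifferentiableAlongAt E F E' φ (s i) x :=
      fun i hi ↦ hs i (Finset.mem_insert_of_mem hi)
    rw [Finset.sum_insert hj, Finset.sum_insert hj, ← ih hI,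
      pullbackConnection_add D (hs j (Finset.mem_insert_self j I)) (.sum hφ hI)]

lemma pullbackConnection_extend (D : CovariantDerivative 𝓘(ℝ, E) F S) {φ : M → N} {x : M}
    (hφ : ContinuousAt φ x) (s : S (φ x)) (u : TangentSpace 𝓘(ℝ, E') x) :
    pullbackConnection F D φ (fun x' ↦ extend F s (φ x')) x u =
      D (extend F s) (φ x) (mfderiv 𝓘(ℝ, E') 𝓘(ℝ, E) φ x u) := by
  rw [pullbackConnection_eq, mvfderiv_congr (coordAlong_extend hφ s), mvfderiv_const]
  simp [connectionForm]

variable [FiniteDimensional ℝ F] [ContMDiffVectorBundle ∞ F S 𝓘(ℝ, E)]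

lemma pullbackConnection_id (D : CovariantDerivative 𝓘(ℝ, E) F S) {σ : Π y : N, S y} {y : N}
    (hσ : MDiffAt (T% σ) y) (u : TangentSpace 𝓘(ℝ, E) y) :
    pullbackConnection F D (fun z ↦ z) σ y u = D σ y u := by
  have htensorial : TensorialAt 𝓘(ℝ, E) F
      (fun σ : Π y : N, S y ↦ pullbackConnection F D (fun z ↦ z) σ y u - D σ y u) y :=
    { smul {a σ} ha hσ := by
        rw [pullbackConnection_smul D ha hσ u, D.isCovariantDerivativeOn.leibniz hσ ha]
        simp only [add_apply, smul_apply, ContinuousLinearMap.smulRight_apply,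
          add_sub_add_right_eq_sub, smul_sub]
      add {σ σ'} hσ hσ' := by
        rw [pullbackConnection_add D hσ hσ' u, D.isCovariantDerivativeOn.add hσ hσ', add_apply]
        exact add_sub_add_comm .. }
  have hextend : MDiffAt (T% (extend F (σ y))) y := mdifferentiableAt_extend ..
  have h : pullbackConnection F D (fun z ↦ z) (extend F (σ y)) y u = D (extend F (σ y)) y u := by
    refine (pullbackConnection_extend D continuousAt_id (σ y) u).trans ?_
    exact congr(D _ y ($(mfderiv_id) u))
  have hpointwise := htensorial.pointwise hσ hextend (extend_apply_self (F := F) (σ y)).symm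
  exact sub_eq_zero.1 (hpointwise.trans (sub_eq_zero.2 h))

lemma pullbackConnection_comp (D : CovariantDerivative 𝓘(ℝ, E) F S) {φ : M → N} {x : M}
    (hφ : MDifferentiableAt 𝓘(ℝ, E') 𝓘(ℝ, E) φ x) {σ : Π y : N, S y} (hσ : MDiffAt (T% σ) (φ x))
    (u : TangentSpace 𝓘(ℝ, E') x) :
    pullbackConnection F D φ (fun x' ↦ σ (φ x')) x u =
      D σ (φ x) (mfderiv 𝓘(ℝ, E') 𝓘(ℝ, E) φ x u) := by
  have hcoord : MDiffAt (coordAlong F (fun z ↦ z) σ (φ x)) (φ x) :=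
    (mdifferentiableAlongAt_iff.1 hσ).2
  have hchain : (d% (coordAlong F φ (fun x' ↦ σ (φ x')) x)) x u =
      (d% (coordAlong F (fun z ↦ z) σ (φ x))) (φ x) (mfderiv 𝓘(ℝ, E') 𝓘(ℝ, E) φ x u) :=
    congr($(mfderiv_comp x hcoord hφ) u)
  rw [← pullbackConnection_id D hσ, pullbackConnection_eq, pullbackConnection_eq, hchain]
  exact congr(_ + connectionForm D (φ x) (σ (φ x)) ($(mfderiv_id) _)).symm

lemma pullbackConnection_eq_sum (D : CovariantDerivative 𝓘(ℝ, E) F S) {φ : M → N} {x : M}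
    (hφ : MDifferentiableAt 𝓘(ℝ, E') 𝓘(ℝ, E) φ x) {s : Π x : M, S (φ x)}
    {ι : Type*} [Fintype ι] {a : ι → M → ℝ} {σ : ι → Π y : N, S y}
    (ha : ∀ i, MDiffAt (a i) x) (hσ : ∀ i, MDiffAt (T% (σ i)) (φ x))
    (hs : ∀ᶠ x' in 𝓝 x, s x' = ∑ i, a i x' • σ i (φ x')) (u : TangentSpace 𝓘(ℝ, E') x) :
    pullbackConnection F D φ s x u =
      ∑ i, (a i x • D (σ i) (φ x) (mfderiv 𝓘(ℝ, E') 𝓘(ℝ, E) φ x u)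
        + (d% (a i)) x u • σ i (φ x)) := by
  have hσφ (i) : MDifferentiableAlongAt E F E' φ (fun x' ↦ σ i (φ x')) x := (hσ i).comp x hφ
  have hs' : ∀ᶠ x' in 𝓝 x, s x' = (∑ i, a i • (fun x' ↦ σ i (φ x'))) x' :=
    hs.mono fun x' hx' ↦ by simp [hx']
  rw [pullbackConnection_congr D hs', pullbackConnection_sum D hφ fun i _ ↦ (hσφ i).smul (ha i)]
  exact Finset.sum_congr rfl fun i _ ↦ by
    rw [pullbackConnection_smul D (ha i) (hσφ i), pullbackConnection_comp D hφ (hσ i)]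

lemma UnbasedAut.Intertwines.pullbackConnection_image [IsManifold 𝓘(ℝ, E) ∞ N]
    {f : UnbasedAut E F S} {D D' : CovariantDerivative 𝓘(ℝ, E) F S} (hf : f.Intertwines D D')
    {φ : M → N} {s : Π x : M, S (φ x)} {x : M} (hs : MDifferentiableAlongAt E F E' φ s x)
    (u : TangentSpace 𝓘(ℝ, E') x) :
    pullbackConnection F D' (f.base ∘ φ) (fun x' ↦ f.fiber (φ x') (s x')) x u =
      f.fiber (φ x) (pullbackConnection F D φ s x u) := by
  obtain ⟨a, σ, ha, hσ, hsum⟩ := exists_frame_expansion hs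
  choose τ hτ using fun i ↦ f.exists_image (σ i)
  have hφ : MDifferentiableAt 𝓘(ℝ, E') 𝓘(ℝ, E) φ x := (mdifferentiableAlongAt_iff.1 hs).1
  have hbase : MDifferentiableAt 𝓘(ℝ, E) 𝓘(ℝ, E) f.base (φ x) :=
    f.base.contMDiff.mdifferentiableAt (by simp)
  have hsum' : ∀ᶠ x' in 𝓝 x, f.fiber (φ x') (s x') = ∑ i, a i x' • τ i ((f.base ∘ φ) x') := by
    filter_upwards [hsum] with x' hx'
    simp [hx', hτ]
  rw [pullbackConnection_eq_sum D hφ ha hσ hsum u,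
    pullbackConnection_eq_sum D' (hbase.comp x hφ) ha
      (fun i ↦ UnbasedAut.mdifferentiableAt_image (hτ i) (hσ i)) hsum' u, map_sum]
  refine Finset.sum_congr rfl fun i _ ↦ ?_
  rw [map_add, map_smul, map_smul, ← hf _ _ (hτ i) _ (hσ i), mfderiv_comp x hbase hφ]
  congr 2
  exact hτ i (φ x)

end PullbackConnection

section Isometries

variable {E : Type*} [NormedAddCommGroup E] [NormedSpace ℝ E]
  {N : Type*} [TopologicalSpace N] [ChartedSpace E N]

lemma tangentMap_symm_tangentMap (ψ : N ≃ₘ⟮𝓘(ℝ, E), 𝓘(ℝ, E)⟯ N) (p : TangentBundle 𝓘(ℝ, E) N) :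
    tangentMap 𝓘(ℝ, E) 𝓘(ℝ, E) ψ.symm (tangentMap 𝓘(ℝ, E) 𝓘(ℝ, E) ψ p) = p := by
  have hcomp : ψ.symm ∘ ψ = id := funext ψ.symm_apply_apply
  rw [← tangentMap_comp_at (I' := 𝓘(ℝ, E)) p (ψ.symm.contMDiff.mdifferentiableAt (by simp))
    (ψ.contMDiff.mdifferentiableAt (by simp)), hcomp, tangentMap_id, id]

variable [IsManifold 𝓘(ℝ, E) ∞ N]

/-- The differential of a diffeomorphism, as an unbased automorphism of the tangent bundle. -/
def tangentAut (ψ : N ≃ₘ⟮𝓘(ℝ, E), 𝓘(ℝ, E)⟯ N) :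
    UnbasedAut E E (TangentSpace 𝓘(ℝ, E) : N → Type _) where
  base := ψ
  fiber y := ψ.mfderivToContinuousLinearEquiv (by simp) y
  total :=
    { toFun := tangentMap 𝓘(ℝ, E) 𝓘(ℝ, E) ψ
      invFun := tangentMap 𝓘(ℝ, E) 𝓘(ℝ, E) ψ.symm
      left_inv := tangentMap_symm_tangentMap ψ
      right_inv := tangentMap_symm_tangentMap ψ.symm
      contMDiff_toFun := ψ.contMDiff.contMDiff_tangentMap (by simp)
      contMDiff_invFun := ψ.symm.contMDiff.contMDiff_tangentMap (by simp) }
  total_mk _ _ := rfl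

@[simp] lemma tangentAut_fiber (ψ : N ≃ₘ⟮𝓘(ℝ, E), 𝓘(ℝ, E)⟯ N) (y : N)
    (u : TangentSpace 𝓘(ℝ, E) y) :
    (tangentAut ψ).fiber y u = mfderiv 𝓘(ℝ, E) 𝓘(ℝ, E) ψ y u := rfl

lemma inverse_mfderiv_apply (ψ : N ≃ₘ⟮𝓘(ℝ, E), 𝓘(ℝ, E)⟯ N) (y : N)
    (v : TangentSpace 𝓘(ℝ, E) (ψ y)) :
    (mfderiv 𝓘(ℝ, E) 𝓘(ℝ, E) ψ y).inverse v = ((tangentAut ψ).fiber y).symm v :=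
  congr($(ContinuousLinearMap.inverse_equiv ((tangentAut ψ).fiber y)) v)

section

variable {ψ : N ≃ₘ⟮𝓘(ℝ, E), 𝓘(ℝ, E)⟯ N} {X Y X' Y' : Π y : N, TangentSpace 𝓘(ℝ, E) y} {y : N}

lemma mpullback_image (hX : ∀ y, X' (ψ y) = (tangentAut ψ).fiber y (X y)) :
    VectorField.mpullback 𝓘(ℝ, E) 𝓘(ℝ, E) ψ X' = X := by
  funext y
  rw [VectorField.mpullback_apply, hX]
  exact (inverse_mfderiv_apply ψ y _).trans (((tangentAut ψ).fiber y).symm_apply_apply _)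

lemma mlieBracket_image [CompleteSpace E]
    (hX : ∀ y, X' (ψ y) = (tangentAut ψ).fiber y (X y))
    (hY : ∀ y, Y' (ψ y) = (tangentAut ψ).fiber y (Y y))
    (hdX : MDiffAt (T% X) y) (hdY : MDiffAt (T% Y) y) :
    VectorField.mlieBracket 𝓘(ℝ, E) X' Y' (ψ y) =
      mfderiv 𝓘(ℝ, E) 𝓘(ℝ, E) ψ y (VectorField.mlieBracket 𝓘(ℝ, E) X Y y) := by
  have h2 : minSmoothness ℝ 2 ≤ ∞ := by
    rw [minSmoothness_of_isRCLikeNormedField]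
    exact WithTop.coe_le_coe.2 (le_top : (2 : ℕ∞) ≤ ⊤)
  have : IsManifold 𝓘(ℝ, E) (minSmoothness ℝ 2) N := IsManifold.of_le h2
  have hpullback := VectorField.mpullback_mlieBracket (f := ψ) (x₀ := y) (n := ∞)
    (UnbasedAut.mdifferentiableAt_image (f := tangentAut ψ) hX hdX)
    (UnbasedAut.mdifferentiableAt_image (f := tangentAut ψ) hY hdY)
    ψ.contMDiff.contMDiffAt h2
  rw [mpullback_image hX, mpullback_image hY] at hpullback
  rw [← hpullback, VectorField.mpullback_apply]
  exact (((tangentAut ψ).fiber y).apply_symm_apply _).symm.trans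
    congr((tangentAut ψ).fiber y $(inverse_mfderiv_apply ψ y _)).symm

end

/-- `ψ` pulls the metric `h'` back to the metric `h`. -/
def IsIsometry (h h' : PseudoRiemannianMetric E N) (ψ : N ≃ₘ⟮𝓘(ℝ, E), 𝓘(ℝ, E)⟯ N) : Prop :=
  ∀ (y : N) (u v : TangentSpace 𝓘(ℝ, E) y),
    h'.val (ψ y) (mfderiv 𝓘(ℝ, E) 𝓘(ℝ, E) ψ y u) (mfderiv 𝓘(ℝ, E) 𝓘(ℝ, E) ψ y v) = h.val y u v

namespace IsIsometry

variable {h h' : PseudoRiemannianMetric E N} {ψ : N ≃ₘ⟮𝓘(ℝ, E), 𝓘(ℝ, E)⟯ N}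
  {X Y Z X' Y' Z' : Π y : N, TangentSpace 𝓘(ℝ, E) y} {y : N}

lemma eq_mfderiv_of_val_eq (hψ : IsIsometry h h' ψ) {v : TangentSpace 𝓘(ℝ, E) y}
    {v' : TangentSpace 𝓘(ℝ, E) (ψ y)}
    (hv : ∀ w, h'.val (ψ y) v' (mfderiv 𝓘(ℝ, E) 𝓘(ℝ, E) ψ y w) = h.val y v w) :
    v' = mfderiv 𝓘(ℝ, E) 𝓘(ℝ, E) ψ y v := by
  refine sub_eq_zero.1 (h'.nondegenerate (ψ y) _ fun w' ↦ ?_)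
  obtain ⟨w, rfl⟩ := ((tangentAut ψ).fiber y).surjective w'
  rw [tangentAut_fiber, map_sub, sub_apply, hψ y, hv, sub_self]

lemma mvfderiv_pair (hψ : IsIsometry h h' ψ)
    (hY : ∀ y, Y' (ψ y) = (tangentAut ψ).fiber y (Y y))
    (hZ : ∀ y, Z' (ψ y) = (tangentAut ψ).fiber y (Z y))
    (hdY : MDiffAt (T% Y) y) (hdZ : MDiffAt (T% Z) y) (u : TangentSpace 𝓘(ℝ, E) y) :
    (d% (h'.pair Y' Z')) (ψ y) (mfderiv 𝓘(ℝ, E) 𝓘(ℝ, E) ψ y u) = (d% (h.pair Y Z)) y u := by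
  have hcomp : h'.pair Y' Z' ∘ ψ = h.pair Y Z := funext fun z ↦ by
    simp only [PseudoRiemannianMetric.pair, Function.comp, hY, hZ, tangentAut_fiber, hψ z]
  have hpair : MDiffAt (h'.pair Y' Z') (ψ y) := PseudoRiemannianMetric.mdifferentiableAt_pair
    (UnbasedAut.mdifferentiableAt_image (f := tangentAut ψ) hY hdY)
    (UnbasedAut.mdifferentiableAt_image (f := tangentAut ψ) hZ hdZ)
  rw [← hcomp]
  exact congr($(mfderiv_comp y hpair (ψ.contMDiff.mdifferentiableAt (by simp))) u).symm

lemma koszul_image [CompleteSpace E] (hψ : IsIsometry h h' ψ)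
    (hX : ∀ y, X' (ψ y) = (tangentAut ψ).fiber y (X y))
    (hY : ∀ y, Y' (ψ y) = (tangentAut ψ).fiber y (Y y))
    (hZ : ∀ y, Z' (ψ y) = (tangentAut ψ).fiber y (Z y))
    (hdX : MDiffAt (T% X) y) (hdY : MDiffAt (T% Y) y) (hdZ : MDiffAt (T% Z) y) :
    h'.koszul X' Y' Z' (ψ y) = h.koszul X Y Z y := by
  simp only [PseudoRiemannianMetric.koszul, mlieBracket_image hX hY hdX hdY,
    mlieBracket_image hX hZ hdX hdZ, mlieBracket_image hY hZ hdY hdZ, hX, hY, hZ,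
    tangentAut_fiber, hψ y, hψ.mvfderiv_pair hX hY hdX hdY, hψ.mvfderiv_pair hX hZ hdX hdZ,
    hψ.mvfderiv_pair hY hZ hdY hdZ]

variable [FiniteDimensional ℝ E]

lemma intertwines_leviCivita (hψ : IsIsometry h h' ψ) :
    (tangentAut ψ).Intertwines h.leviCivita h'.leviCivita := by
  intro Y Y' hY y hdY u
  refine hψ.eq_mfderiv_of_val_eq fun w ↦ ?_
  have hdX := mdifferentiableAt_extend 𝓘(ℝ, E) E (x := y) u
  have hdZ := mdifferentiableAt_extend 𝓘(ℝ, E) E (x := y) w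
  obtain ⟨X', hX⟩ := (tangentAut ψ).exists_image (extend E u)
  obtain ⟨Z', hZ⟩ := (tangentAut ψ).exists_image (extend E w)
  have hX'y : X' (ψ y) = mfderiv 𝓘(ℝ, E) 𝓘(ℝ, E) ψ y u :=
    (hX y).trans congr((tangentAut ψ).fiber y $(extend_apply_self E u))
  have hZ'y : Z' (ψ y) = mfderiv 𝓘(ℝ, E) 𝓘(ℝ, E) ψ y w :=
    (hZ y).trans congr((tangentAut ψ).fiber y $(extend_apply_self E w))
  have hkoszul : 2 * h.val y (h.leviCivita Y y (extend E u y)) (extend E w y) =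
      h.koszul (extend E u) Y (extend E w) y :=
    PseudoRiemannianMetric.val_leviCivitaAux hdX hdY hdZ
  have hkoszul' : 2 * h'.val (ψ y) (h'.leviCivita Y' (ψ y) (X' (ψ y))) (Z' (ψ y)) =
      h'.koszul X' Y' Z' (ψ y) :=
    PseudoRiemannianMetric.val_leviCivitaAux
      (UnbasedAut.mdifferentiableAt_image (f := tangentAut ψ) hX hdX)
      (UnbasedAut.mdifferentiableAt_image (f := tangentAut ψ) hY hdY)
      (UnbasedAut.mdifferentiableAt_image (f := tangentAut ψ) hZ hdZ)
  rw [extend_apply_self, extend_apply_self] at hkoszul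
  rw [hX'y, hZ'y, hψ.koszul_image hX hY hZ hdX hdY hdZ, ← hkoszul] at hkoszul'
  exact mul_left_cancel₀ two_ne_zero hkoszul'

lemma sharp_image (hψ : IsIsometry h h' ψ)
    {α : Dual ℝ (TangentSpace 𝓘(ℝ, E) y)} {α' : Dual ℝ (TangentSpace 𝓘(ℝ, E) (ψ y))}
    (hα : ∀ u, α' (mfderiv 𝓘(ℝ, E) 𝓘(ℝ, E) ψ y u) = α u) :
    h'.sharp (ψ y) α' = mfderiv 𝓘(ℝ, E) 𝓘(ℝ, E) ψ y (h.sharp y α) :=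
  hψ.eq_mfderiv_of_val_eq fun w ↦ by
    rw [PseudoRiemannianMetric.val_sharp, PseudoRiemannianMetric.val_sharp, hα]

end IsIsometry

end Isometries

section MultilinearAlgebra

lemma rTensor_dualMap_dualTensorHomEquiv_symm {R U V W W' : Type*} [CommRing R]
    [AddCommGroup U] [Module R U] [Module.Free R U] [Module.Finite R U]
    [AddCommGroup V] [Module R V] [Module.Free R V] [Module.Finite R V]
    [AddCommGroup W] [Module R W] [AddCommGroup W'] [Module R W']
    {B : U →ₗ[R] V} {C : W →ₗ[R] W'} {Θ : U →ₗ[R] W} {Θ' : V →ₗ[R] W'} (h : Θ' ∘ₗ B = C ∘ₗ Θ) :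
    B.dualMap.rTensor W' ((dualTensorHomEquiv R V W').symm Θ') =
      C.lTensor (Dual R U) ((dualTensorHomEquiv R U W).symm Θ) := by
  apply (dualTensorHomEquiv R U W').injective
  calc dualTensorHom R U W' (B.dualMap.rTensor W' ((dualTensorHomEquiv R V W').symm Θ'))
      = dualTensorHom R V W' ((dualTensorHomEquiv R V W').symm Θ') ∘ₗ B :=
        congr($(dualTensorHom_comp_rTensor_dualMap B) _)
    _ = C ∘ₗ dualTensorHom R U W ((dualTensorHomEquiv R U W).symm Θ) :=
        ((congrArg (· ∘ₗ B) ((dualTensorHomEquiv R V W').apply_symm_apply Θ')).trans h).trans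
          (congrArg (C ∘ₗ ·) ((dualTensorHomEquiv R U W).apply_symm_apply Θ)).symm
    _ = dualTensorHom R U W' (C.lTensor (Dual R U) ((dualTensorHomEquiv R U W).symm Θ)) :=
        congr($(dualTensorHom_comp_lTensor C) _).symm

lemma compAlternatingMap_injective {R T W W' ι : Type*} [Semiring R] [AddCommMonoid T] [Module R T]
    [AddCommMonoid W] [Module R W] [AddCommMonoid W'] [Module R W'] {A : W →ₗ[R] W'}
    (hA : Function.Injective A) :
    Function.Injective (A.compAlternatingMap : T [⋀^ι]→ₗ[R] W → T [⋀^ι]→ₗ[R] W') :=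
  fun _ _ h ↦ AlternatingMap.ext fun v ↦ hA congr($h v)

lemma conj_apply_map {R W W' : Type*} [CommSemiring R] [AddCommMonoid W] [Module R W]
    [AddCommMonoid W'] [Module R W'] (e : W ≃ₗ[R] W') (A : W →ₗ[R] W) (s : W) :
    e.conj A (e s) = e (A s) := by
  rw [LinearEquiv.conj_apply_apply, LinearEquiv.symm_apply_apply]

variable {M : Type*} [TopologicalSpace M] [ChartedSpace (EuclideanSpace ℝ (Fin 4)) M]
  [IsManifold (𝓡 4) ∞ M]
  {W W' : Type*} [AddCommGroup W] [Module ℝ W] [AddCommGroup W'] [Module ℝ W']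

namespace LorentzianMetric

variable (g : LorentzianMetric M)

lemma hodge_compAlternatingMap (o : ManifoldOrientation M) (x : M) (A : W →ₗ[ℝ] W')
    (η : TangentSpace (𝓡 4) x [⋀^Fin 2]→ₗ[ℝ] W) :
    g.hodge o x (A.compAlternatingMap η) = A.compAlternatingMap (g.hodge o x η) := by
  change _ = LinearMap.compAlternatingMapₗ (S := ℝ) A (g.hodge o x η)
  simp only [hodge, map_smul, map_sum]
  refine congrArg _ (Finset.sum_congr rfl fun i _ ↦ Finset.sum_congr rfl fun j _ ↦ ?_)
  ext v
  simp

variable (x : M) {Q : W →ₗ[ℝ] W →ₗ[ℝ] ℝ} {Q' : W' →ₗ[ℝ] W' →ₗ[ℝ] ℝ} {A : W →ₗ[ℝ] W'}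
  (ρ η : TangentSpace (𝓡 4) x [⋀^Fin 2]→ₗ[ℝ] W)

lemma twoFormInner_compAlternatingMap (hA : ∀ s t, Q' (A s) (A t) = Q s t) :
    g.twoFormInner x Q' (A.compAlternatingMap ρ) (A.compAlternatingMap η) =
      g.twoFormInner x Q ρ η := by
  simp [twoFormInner, hA]

lemma tensorPairing_tmul {T : Type*} [AddCommGroup T] [Module ℝ T] (v : T) (R : W →ₗ[ℝ] W) :
    g.tensorPairing x Q ρ η (v ⊗ₜ R) = g.twoFormInner x Q ρ (R.compAlternatingMap η) • v := rfl

lemma tensorPairing_add {T : Type*} [AddCommGroup T] [Module ℝ T] (t₁ t₂ : T ⊗[ℝ] (W →ₗ[ℝ] W)) :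
    g.tensorPairing x Q ρ η (t₁ + t₂) =
      g.tensorPairing x Q ρ η t₁ + g.tensorPairing x Q ρ η t₂ := by
  simp only [tensorPairing, map_add]

lemma tensorPairing_map {T T' : Type*} [AddCommGroup T] [Module ℝ T] [AddCommGroup T']
    [Module ℝ T'] (hA : ∀ s t, Q' (A s) (A t) = Q s t) (B : T →ₗ[ℝ] T')
    {C : (W →ₗ[ℝ] W) →ₗ[ℝ] W' →ₗ[ℝ] W'} (hC : ∀ R s, C R (A s) = A (R s))
    (t : T ⊗[ℝ] (W →ₗ[ℝ] W)) :
    g.tensorPairing x Q' (A.compAlternatingMap ρ) (A.compAlternatingMap η)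
        (TensorProduct.map B C t) =
      B (g.tensorPairing x Q ρ η t) := by
  induction t using TensorProduct.induction_on with
  | zero => simp only [tensorPairing, map_zero]
  | tmul v R =>
    have hR : (C R).compAlternatingMap (A.compAlternatingMap η) =
        A.compAlternatingMap (R.compAlternatingMap η) := by
      ext v
      exact hC R (η v)
    rw [TensorProduct.map_tmul, tensorPairing_tmul, tensorPairing_tmul, hR,
      g.twoFormInner_compAlternatingMap x ρ _ hA, map_smul]
  | add t₁ t₂ h₁ h₂ => rw [map_add, tensorPairing_add, tensorPairing_add, h₁, h₂, map_add]

end LorentzianMetric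

end MultilinearAlgebra

section Tension

variable {E : Type*} [NormedAddCommGroup E] [NormedSpace ℝ E] [FiniteDimensional ℝ E]
  {N : Type*} [TopologicalSpace N] [ChartedSpace E N] [IsManifold 𝓘(ℝ, E) ∞ N]
  {M : Type*} [TopologicalSpace M] [ChartedSpace (EuclideanSpace ℝ (Fin 4)) M]
  [IsManifold (𝓡 4) ∞ M]
  {ψ : N ≃ₘ⟮𝓘(ℝ, E), 𝓘(ℝ, E)⟯ N}

namespace IsIsometry

variable (g : LorentzianMetric M) {h h' : PseudoRiemannianMetric E N} {φ : M → N}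

lemma secondFundamentalForm_comp (hψ : IsIsometry h h' ψ) (hφ : ContMDiff (𝓡 4) 𝓘(ℝ, E) ∞ φ)
    (x : M) (u v : TangentSpace (𝓡 4) x) :
    secondFundamentalForm g h' (ψ ∘ φ) x u v =
      mfderiv 𝓘(ℝ, E) 𝓘(ℝ, E) ψ (φ x) (secondFundamentalForm g h φ x u v) := by
  have hcomp (x' : M) (w : TangentSpace (𝓡 4) x') : mfderiv (𝓡 4) 𝓘(ℝ, E) (ψ ∘ φ) x' w =
      mfderiv 𝓘(ℝ, E) 𝓘(ℝ, E) ψ (φ x') (mfderiv (𝓡 4) 𝓘(ℝ, E) φ x' w) :=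
    congr($(mfderiv_comp x' (ψ.contMDiff.mdifferentiableAt (by simp))
      (hφ.mdifferentiableAt (by simp))) w)
  have hdφ : MDifferentiableAlongAt E E (EuclideanSpace ℝ (Fin 4)) φ
      (fun x' ↦ mfderiv (𝓡 4) 𝓘(ℝ, E) φ x' (extend (EuclideanSpace ℝ (Fin 4)) v x')) x :=
    ((hφ.contMDiff_tangentMap (m := ∞) (by simp)).mdifferentiableAt (by simp)).comp x
      (mdifferentiableAt_extend (𝓡 4) (EuclideanSpace ℝ (Fin 4)) v)
  have hpullback := hψ.intertwines_leviCivita.pullbackConnection_image hdφ u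
  simp only [secondFundamentalForm, hcomp]
  rw [map_sub]
  exact congrArg (fun w : TangentSpace 𝓘(ℝ, E) (ψ (φ x)) ↦ w - _) hpullback

lemma tensionField_comp (hψ : IsIsometry h h' ψ) (hφ : ContMDiff (𝓡 4) 𝓘(ℝ, E) ∞ φ) (x : M) :
    tensionField g h' (ψ ∘ φ) x =
      mfderiv 𝓘(ℝ, E) 𝓘(ℝ, E) ψ (φ x) (tensionField g h φ x) := by
  simp only [tensionField, LorentzianMetric.trace, map_sum, hψ.secondFundamentalForm_comp g hφ]

variable {𝒮 𝒮' : ScalarStructure E N}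

lemma grad_image (hψ : IsIsometry 𝒮.metric 𝒮'.metric ψ) (hΦ : ∀ y, 𝒮'.Φ (ψ y) = 𝒮.Φ y) (y : N) :
    𝒮'.grad (ψ y) = mfderiv 𝓘(ℝ, E) 𝓘(ℝ, E) ψ y (𝒮.grad y) := by
  refine hψ.sharp_image fun u ↦ ?_
  have hcomp : 𝒮'.Φ ∘ ψ = 𝒮.Φ := funext hΦ
  rw [← hcomp]
  exact congr($(mfderiv_comp y (𝒮'.contMDiff_Φ.mdifferentiableAt (by simp))
    (ψ.contMDiff.mdifferentiableAt (by simp))) u).symm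

lemma modifiedTensionField_comp (hψ : IsIsometry 𝒮.metric 𝒮'.metric ψ)
    (hΦ : ∀ y, 𝒮'.Φ (ψ y) = 𝒮.Φ y) (hφ : ContMDiff (𝓡 4) 𝓘(ℝ, E) ∞ φ) (x : M) :
    modifiedTensionField g 𝒮' (ψ ∘ φ) x =
      mfderiv 𝓘(ℝ, E) 𝓘(ℝ, E) ψ (φ x) (modifiedTensionField g 𝒮 φ x) := by
  rw [modifiedTensionField, modifiedTensionField, map_sub, hψ.tensionField_comp g hφ]
  exact congrArg (fun w : TangentSpace 𝓘(ℝ, E) (ψ (φ x)) ↦ _ - w) (hψ.grad_image hΦ (φ x))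

end IsIsometry

end Tension

section Isomorphisms

variable {E : Type*} [NormedAddCommGroup E] [NormedSpace ℝ E]
  {N : Type*} [TopologicalSpace N] [ChartedSpace E N] [IsManifold 𝓘(ℝ, E) ∞ N]
  {F : Type*} [NormedAddCommGroup F] [NormedSpace ℝ F]
  {S : N → Type*} [TopologicalSpace (TotalSpace F S)]
  [∀ y, AddCommGroup (S y)] [∀ y, Module ℝ (S y)] [∀ y, TopologicalSpace (S y)]
  [∀ y, IsTopologicalAddGroup (S y)] [∀ y, ContinuousSMul ℝ (S y)]
  [FiberBundle F S] [VectorBundle ℝ F S] [ContMDiffVectorBundle ∞ F S 𝓘(ℝ, E)]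

variable {M : Type*} [TopologicalSpace M] [ChartedSpace (EuclideanSpace ℝ (Fin 4)) M]
  [IsManifold (𝓡 4) ∞ M]

variable {f : UnbasedAut E F S} {c : FieldPair E F S M}

namespace UnbasedAut.Intertwines

lemma twistedExtDeriv_smul [FiniteDimensional ℝ F] {D D' : CovariantDerivative 𝓘(ℝ, E) F S}
    (hf : f.Intertwines D D')
    {X Y Z : Π x : M, TangentSpace (𝓡 4) x} (hX : IsSmoothVectorField X)
    (hY : IsSmoothVectorField Y) (hZ : IsSmoothVectorField Z) (x : M) :
    twistedExtDeriv F D' (f • c).φ (f • c).V X Y Z x =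
      f.fiber (c.φ x) (twistedExtDeriv F D c.φ c.V X Y Z x) := by
  have hpullback {X Y : Π x : M, TangentSpace (𝓡 4) x} (hX : IsSmoothVectorField X)
      (hY : IsSmoothVectorField Y) (u : TangentSpace (𝓡 4) x) :
      pullbackConnection F D' (f • c).φ (fun x' ↦ (f • c).V x' ![X x', Y x']) x u =
        f.fiber (c.φ x) (pullbackConnection F D c.φ (fun x' ↦ c.V x' ![X x', Y x']) x u) :=
    hf.pullbackConnection_image ((c.contMDiff_V X Y hX hY).mdifferentiableAt (by simp)) u
  simp only [twistedExtDeriv, map_sub, map_add]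
  rw [hpullback hX hY, hpullback hX hZ, hpullback hY hZ]
  rfl

lemma solvesElectromagnetic_smul_iff [FiniteDimensional ℝ F] {Δ Δ' : DualityStructure E F S}
    (hf : f.Intertwines Δ.D Δ'.D) :
    (f • c).SolvesElectromagnetic Δ' ↔ c.SolvesElectromagnetic Δ := by
  refine forall₃_congr fun X Y Z ↦ forall₃_congr fun hX hY hZ ↦ forall_congr' fun x ↦ ?_
  rw [hf.twistedExtDeriv_smul hX hY hZ]
  exact map_eq_zero_iff _ (f.fiber (c.φ x)).injective

end UnbasedAut.Intertwines

/-- `f` is an isomorphism from the scalar-electromagnetic structure `𝒟` to the structure `𝒟'` on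
the same bundle. The symmetries of `𝒟` are its isomorphisms to itself. -/
structure UnbasedAut.IsIsomorphism (f : UnbasedAut E F S)
    (𝒟 𝒟' : ScalarElectromagneticStructure E F S) : Prop where
  isIsometry : IsIsometry 𝒟.scalar.metric 𝒟'.scalar.metric f.base
  map_Φ (y : N) : 𝒟'.scalar.Φ (f.base y) = 𝒟.scalar.Φ y
  map_symp (y : N) (s t : S y) :
    𝒟'.em.symp (f.base y) (f.fiber y s) (f.fiber y t) = 𝒟.em.symp y s t
  intertwines : f.Intertwines 𝒟.em.D 𝒟'.em.D
  map_J (y : N) (s : S y) : f.fiber y (𝒟.em.J y s) = 𝒟'.em.J (f.base y) (f.fiber y s)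

variable {𝒟 𝒟' : ScalarElectromagneticStructure E F S} {o : ManifoldOrientation M}
  {g : LorentzianMetric M}

lemma UnbasedAut.IsIsomorphism.of_mem_symmetryGroup (hf : f ∈ 𝒟.symmetryGroup) :
    f.IsIsomorphism 𝒟 𝒟 :=
  let ⟨⟨⟨hsymp, hD⟩, hiso, hΦ⟩, hJ⟩ := hf
  ⟨hiso, hΦ, hsymp, hD, (UnbasedAut.Ad_eq_iff _ _ _).1 hJ⟩

namespace UnbasedAut.IsIsomorphism

lemma Q_image (hf : f.IsIsomorphism 𝒟 𝒟') (y : N) (s t : S y) :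
    𝒟'.em.Q (f.base y) (f.fiber y s) (f.fiber y t) = 𝒟.em.Q y s t := by
  rw [ElectromagneticStructure.Q_apply, ElectromagneticStructure.Q_apply, ← hf.map_J, hf.map_symp]

lemma fundamentalForm_image [FiniteDimensional ℝ F] (hf : f.IsIsomorphism 𝒟 𝒟') (y : N)
    (u : TangentSpace 𝓘(ℝ, E) y) (s : S y) :
    𝒟'.em.fundamentalForm (f.base y) (mfderiv 𝓘(ℝ, E) 𝓘(ℝ, E) f.base y u) (f.fiber y s) =
      f.fiber y (𝒟.em.fundamentalForm y u s) := by
  have hs : MDiffAt (T% (extend F s)) y := mdifferentiableAt_extend 𝓘(ℝ, E) F s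
  obtain ⟨τ, hτ⟩ := f.exists_image (extend F s)
  have hJτ (z : N) : 𝒟'.em.J (f.base z) (τ (f.base z)) = f.fiber z (𝒟.em.J z (extend F s z)) := by
    rw [hτ, hf.map_J]
  have hΘ := 𝒟.em.fundamentalForm_apply hs u
  have hΘ' := 𝒟'.em.fundamentalForm_apply (UnbasedAut.mdifferentiableAt_image hτ hs)
    (mfderiv 𝓘(ℝ, E) 𝓘(ℝ, E) f.base y u)
  rw [hτ, extend_apply_self, hf.intertwines _ _ hτ y hs,
    hf.intertwines _ (fun z ↦ 𝒟'.em.J z (τ z)) hJτ y (𝒟.em.mdifferentiableAt_J hs)] at hΘ'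
  rw [extend_apply_self] at hΘ
  rw [hΘ', hΘ, map_sub, hf.map_J]

lemma smul_mem_Conf_iff (hf : f.IsIsomorphism 𝒟 𝒟') : f • c ∈ 𝒟'.Conf o g ↔ c ∈ 𝒟.Conf o g := by
  refine forall_congr' fun x ↦ ?_
  let A : S (c.φ x) →ₗ[ℝ] S (f.base (c.φ x)) := (f.fiber (c.φ x)).toLinearEquiv.toLinearMap
  have hJ : (𝒟'.em.J (f.base (c.φ x))).toLinearMap.compAlternatingMap
      (A.compAlternatingMap (c.V x)) =
        A.compAlternatingMap ((𝒟.em.J (c.φ x)).toLinearMap.compAlternatingMap (c.V x)) := by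
    ext v
    exact (hf.map_J (c.φ x) (c.V x v)).symm
  have hhodge := (congrArg (g.hodge o x) hJ).trans (g.hodge_compAlternatingMap o x A _)
  exact (Eq.congr_left hhodge).trans
    (compAlternatingMap_injective (f.fiber (c.φ x)).injective).eq_iff

variable [FiniteDimensional ℝ E]

lemma fundamentalField_image [FiniteDimensional ℝ F] (hf : f.IsIsomorphism 𝒟 𝒟') (y : N) :
    𝒟'.fundamentalField (f.base y) =
      TensorProduct.map (mfderiv 𝓘(ℝ, E) 𝓘(ℝ, E) f.base y).toLinearMap
        (f.fiber y).toLinearEquiv.conj.toLinearMap (𝒟.fundamentalField y) := by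
  let df := (mfderiv 𝓘(ℝ, E) 𝓘(ℝ, E) f.base y).toLinearMap
  let conj := (f.fiber y).toLinearEquiv.conj.toLinearMap
  have hΘ : 𝒟'.em.fundamentalForm (f.base y) ∘ₗ df = conj ∘ₗ 𝒟.em.fundamentalForm y := by
    ext u s
    obtain ⟨s, rfl⟩ := (f.fiber y).surjective s
    exact (hf.fundamentalForm_image y u s).trans (conj_apply_map (f.fiber y).toLinearEquiv _ s).symm
  have hsharp : (𝒟'.scalar.metric.sharp (f.base y)).toLinearMap =
      df ∘ₗ (𝒟.scalar.metric.sharp y).toLinearMap ∘ₗ df.dualMap :=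
    LinearMap.ext fun α ↦ hf.isIsometry.sharp_image fun _ ↦ rfl
  change LinearMap.rTensor _ _ _ = TensorProduct.map _ _ (LinearMap.rTensor _ _ _)
  rw [hsharp, LinearMap.rTensor_comp, LinearMap.rTensor_comp, LinearMap.comp_apply,
    LinearMap.comp_apply, rTensor_dualMap_dualTensorHomEquiv_symm hΘ]
  simp only [LinearMap.rTensor, LinearMap.lTensor, TensorProduct.map_map, LinearMap.comp_id,
    LinearMap.id_comp, df, conj]

lemma tensorPairing_smul [FiniteDimensional ℝ F] (hf : f.IsIsomorphism 𝒟 𝒟') (x : M) :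
    g.tensorPairing x (𝒟'.em.Q ((f • c).φ x)) (g.hodge o x ((f • c).V x)) ((f • c).V x)
        (𝒟'.fundamentalField ((f • c).φ x)) =
      mfderiv 𝓘(ℝ, E) 𝓘(ℝ, E) f.base (c.φ x)
        (g.tensorPairing x (𝒟.em.Q (c.φ x)) (g.hodge o x (c.V x)) (c.V x)
          (𝒟.fundamentalField (c.φ x))) := by
  have hsource := g.tensorPairing_map x (g.hodge o x (c.V x)) (c.V x) (hf.Q_image (c.φ x))
    (mfderiv 𝓘(ℝ, E) 𝓘(ℝ, E) f.base (c.φ x)).toLinearMap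
    (conj_apply_map (f.fiber (c.φ x)).toLinearEquiv) (𝒟.fundamentalField (c.φ x))
  rw [← g.hodge_compAlternatingMap] at hsource
  refine .trans ?_ hsource
  exact congrArg (g.tensorPairing x _ _ _) (hf.fundamentalField_image (c.φ x))

lemma solvesScalar_smul_iff [FiniteDimensional ℝ F] (hf : f.IsIsomorphism 𝒟 𝒟') :
    (f • c).SolvesScalar o g 𝒟' ↔ c.SolvesScalar o g 𝒟 := by
  refine forall_congr' fun x ↦ ?_
  have hθ := hf.isIsometry.modifiedTensionField_comp g hf.map_Φ c.contMDiff_φ x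
  have hinj := ((tangentAut f.base).fiber (c.φ x)).injective
  rw [hf.tensorPairing_smul, ← map_eq_zero_iff _ hinj, map_sub, map_smul]
  exact Eq.congr_left
    (congrArg (fun w : TangentSpace 𝓘(ℝ, E) (f.base (c.φ x)) ↦ w - _) hθ)

lemma smul_mem_Sol_iff [FiniteDimensional ℝ F] (hf : f.IsIsomorphism 𝒟 𝒟') :
    f • c ∈ 𝒟'.Sol o g ↔ c ∈ 𝒟.Sol o g :=
  and_congr hf.smul_mem_Conf_iff
    (and_congr hf.solvesScalar_smul_iff hf.intertwines.solvesElectromagnetic_smul_iff)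

end UnbasedAut.IsIsomorphism

end Isomorphisms

end ESM

end

theorem mainTheorem2_general
    {E : Type*} [NormedAddCommGroup E] [NormedSpace ℝ E] [FiniteDimensional ℝ E]
    {N : Type*} [TopologicalSpace N] [ChartedSpace E N] [IsManifold 𝓘(ℝ, E) ∞ N]
    {F : Type*} [NormedAddCommGroup F] [NormedSpace ℝ F] [FiniteDimensional ℝ F]
    {S : N → Type*} [TopologicalSpace (TotalSpace F S)]
    [∀ y, AddCommGroup (S y)] [∀ y, Module ℝ (S y)] [∀ y, TopologicalSpace (S y)]
    [∀ y, IsTopologicalAddGroup (S y)] [∀ y, ContinuousSMul ℝ (S y)]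
    [FiberBundle F S] [VectorBundle ℝ F S] [ContMDiffVectorBundle ∞ F S 𝓘(ℝ, E)]
    {M : Type*} [TopologicalSpace M] [ChartedSpace (EuclideanSpace ℝ (Fin 4)) M]
    [IsManifold (𝓡 4) ∞ M] (o : ESM.ManifoldOrientation M) (g : ESM.LorentzianMetric M)
    {𝒟 𝒟' : ESM.ScalarElectromagneticStructure E F S} {f : ESM.UnbasedAut E F S}
    (hf : f.IsIsomorphism 𝒟 𝒟') :
    (fun c : ESM.FieldPair E F S M ↦ f • c) '' 𝒟.Sol o g = 𝒟'.Sol o g ∧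
    ∀ c : ESM.FieldPair E F S M, (f • c ∈ 𝒟'.Conf o g ↔ c ∈ 𝒟.Conf o g) ∧
      (f • c ∈ 𝒟'.Sol o g ↔ c ∈ 𝒟.Sol o g) := by
  have hSol : 𝒟.Sol o g = (fun c : ESM.FieldPair E F S M ↦ f • c) ⁻¹' 𝒟'.Sol o g :=
    Set.ext fun _ ↦ hf.smul_mem_Sol_iff.symm
  refine ⟨?_, fun c ↦ ⟨hf.smul_mem_Conf_iff, hf.smul_mem_Sol_iff⟩⟩
  rw [hSol, Set.image_preimage_eq _ (MulAction.surjective f)]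

theorem mainTheorem2
    -- the scalar manifold `N`
    {E : Type*} [NormedAddCommGroup E] [NormedSpace ℝ E] [FiniteDimensional ℝ E]
    {N : Type*} [TopologicalSpace N] [T2Space N] [SecondCountableTopology N] [ConnectedSpace N]
    [ChartedSpace E N] [IsManifold 𝓘(ℝ, E) ∞ N]
    -- the vector bundle `S` on `N`
    {F : Type*} [NormedAddCommGroup F] [NormedSpace ℝ F] [FiniteDimensional ℝ F]
    {S : N → Type*} [TopologicalSpace (TotalSpace F S)]
    [∀ y, AddCommGroup (S y)] [∀ y, Module ℝ (S y)] [∀ y, TopologicalSpace (S y)]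
    [∀ y, IsTopologicalAddGroup (S y)] [∀ y, ContinuousSMul ℝ (S y)]
    [FiberBundle F S] [VectorBundle ℝ F S] [ContMDiffVectorBundle ∞ F S 𝓘(ℝ, E)]
    -- the oriented four-manifold `M`
    {M : Type*} [TopologicalSpace M] [T2Space M] [SecondCountableTopology M] [ConnectedSpace M]
    [ChartedSpace (EuclideanSpace ℝ (Fin 4)) M] [IsManifold (𝓡 4) ∞ M]
    (o : ESM.ManifoldOrientation M)
    -- the scalar-electromagnetic structure, the Lorentzian metric and the symmetry
    (𝒟 : ESM.ScalarElectromagneticStructure E F S) (g : ESM.LorentzianMetric M)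
    (f : ESM.UnbasedAut E F S) (hf : f ∈ 𝒟.symmetryGroup) :
    (fun c : ESM.FieldPair E F S M ↦ f • c) '' 𝒟.Sol o g = 𝒟.Sol o g ∧
    ∀ c ∈ 𝒟.Conf o g, f • c ∈ 𝒟.Conf o g ∧ (f • c ∈ 𝒟.Sol o g ↔ c ∈ 𝒟.Sol o g) := by
  obtain ⟨himage, hiff⟩ :=
    mainTheorem2_general o g (ESM.UnbasedAut.IsIsomorphism.of_mem_symmetryGroup hf)
  exact ⟨himage, fun c hc ↦ ⟨(hiff c).1.2 hc, (hiff c).2⟩⟩
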